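/- Let $k\ge 1$, $m\ge 0$ be integers and let $\Omega=(\Omega_1,\dots,\Omega_{d_{\max}})$, $d_{\max}\le k$, be a probability distribution on $\{1,\dots,d_{\max}\}$. Consider the random bipartite graph with $k$ input symbols and $m$ output symbols in which the output symbols are independent and each one draws a degree $d$ according to $\Omega$ and then a uniformly random set of $d$ distinct input symbols as its neighbours. Triangularization with random inactivations runs on this graph for $k$ steps, starting with all input symbols active. The reduced degree of an output symbol is the number of its active neighbours; when $u$ input symbols are active, the ripple $\mathscr R_u$ is the set of output symbols of reduced degree $1$ and the cloud $\mathscr C_u$ the set of output symbols of reduced degree at least $2$. In the transition from $u$ to $u-1$ active input symbols, if $\mathscr R_u\ne\emptyset$, an element of $\mathscr R_u$ is chosen uniformly at random and its unique active neighbour is marked resolvable and stops being active; if $\mathscr R_u=\emptyset$, a uniformly chosen active input symbol is marked inactive (an inactivation) and stops being active. Let $\mathsf C_u=|\mathscr C_u|$, $\mathsf R_u=|\mathscr R_u|$, $\mathsf S_u=(\mathsf C_u,\mathsf R_u)$, $\mathsf B_u=|\mathscr C_u\cap\mathscr R_{u-1}|$, $\mathsf A_u=|\mathscr R_u\setminus\mathscr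 R_{u-1}|$, and let $\mathsf N$ be the total number of inactivations in the $k$ steps. Almost surely exactly $u$ input symbols are active at index $u$, for all $0\le u\le k$, and for every $1\le u\le k$ the following holds. (1) For every output symbol $c$, $$\Pr\{c\in\mathscr C_u\}=1-\sum_{d=1}^{d_{\max}}\Omega_d\left[u\frac{\binom{k-u}{d-1}}{\binom kd}+\frac{\binom{k-u}{d}}{\binom kd}\right],\qquad \Pr\{c\in\mathscr R_{u-1},\,c\in\mathscr C_u\}=\sum_{d=2}^{d_{\max}}\Omega_d\,\frac dk\,(d-1)\,\frac{u-1}{k-1}\,\frac{\binom{k-u}{d-2}}{\binom{k-2}{d-2}}.$$ Let $p_u$ be the second expression divided by the first, with $p_u=0$ if the first is $0$; so $p_u=\Pr\{c\in\mathscr R_{u-1}\mid c\in\mathscr C_u\}$ whenever the condition has positive probability. (2) $\Pr\{\mathsf S_k=(c,r)\}=\binom mr\Omega_1^{r}(1-\Omega_1)^{c}$ for all $c,r\ge0$ with $c+r=m$, and $\Pr\{\mathsf S_k=(c,r)\}=0$ for all other $(c,r)$. (3) Almost surely $\mathsf S_{u-1}=(\mathsf C_u-\mathsf B_u,\ \mathsf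 R_u-\mathsf A_u+\mathsf B_u)$. Conditionally on any event $\{\mathsf S_k=s_k,\dots,\mathsf S_u=s_u\}$ of positive probability, with $s_u=(c_u,r_u)$, the variables $\mathsf B_u$ and $\mathsf A_u$ are independent, $\mathsf B_u$ is binomial with parameters $c_u$ and $p_u$, and, if $r_u>0$, $\mathsf A_u-1$ is binomial with parameters $r_u-1$ and $1/u$, while $\mathsf A_u=0$ if $r_u=0$. (4) Consequently $\mathsf S_k,\mathsf S_{k-1},\dots,\mathsf S_0$ is a Markov chain: conditionally on any event $\{\mathsf S_k=s_k,\dots,\mathsf S_u=(c_u,r_u)\}$ of positive probability, the probability of $\mathsf S_{u-1}=(c_u-b,\,r_u-a+b)$ is, for $0\le b\le c_u$, $$\binom{c_u}{b}p_u^{b}(1-p_u)^{c_u-b}\binom{r_u-1}{a-1}\Big(\frac1u\Big)^{a-1}\Big(1-\frac1u\Big)^{r_u-a}\quad\text{if } r_u>0,\ 1\le a\le r_u,$$ $$\binom{c_u}{b}p_u^{b}(1-p_u)^{c_u-b}\quad\text{if } r_u=0,\ a=0,$$ and all other states have conditional probability $0$. Writing $P_u(s,s')$ for these transition probabilities, $\Pr\{\mathsf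 S_{u-1}=s'\}=\sum_{s}\Pr\{\mathsf S_u=s\}\,P_u(s,s')$ for all $s'$, the sum being over $s\in\{0,\dots,m\}^2$. (5) $\mathsf N$ is integrable and $$\mathsf E[\mathsf N]=\sum_{u=1}^{k}\sum_{c=0}^{m}\Pr\{\mathsf S_u=(c,0)\}.$$ -/

import Mathlib

noncomputable section

namespace LT

/-! ## Random LT code graphs -/

/-- The bipartite graph of an LT code with `k` input symbols and `m` output symbols, given by the
set of neighbours (input symbols) of every output symbol. -/
abbrev Graph (k m : ℕ) : Type := Fin m → Finset (Fin k)

/-- The neighbour set of one output symbol: draw a degree `d` from the output degree distribution,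
then `d` distinct input symbols uniformly at random. (The branch `pure ∅` is only reached for
`d > k`, which has probability zero for the distributions considered.) -/
def nbrLaw (k : ℕ) (Ω : PMF ℕ) : PMF (Finset (Fin k)) :=
  Ω.bind fun d =>
    if h : (Finset.powersetCard d (Finset.univ : Finset (Fin k))).Nonempty then
      PMF.uniformOfFinset (Finset.powersetCard d (Finset.univ : Finset (Fin k))) h
    else PMF.pure ∅

/-- The law of the graph: the `m` output symbols are independent and identically distributed. -/
def graphLaw (k m : ℕ) (Ω : PMF ℕ) : PMF (Graph k m) :=
  PMF.ofFintype (fun G => ∏ j, nbrLaw k Ω (G j)) <| by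
    have h : ∑ S, nbrLaw k Ω S = 1 := by
      rw [← tsum_fintype (L := .unconditional _)]
      exact (nbrLaw k Ω).tsum_coe
    have := Finset.prod_univ_sum (ι := Fin m) (κ := fun _ => Finset (Fin k))
      (fun _ => Finset.univ) (fun _ S => nbrLaw k Ω S)
    rw [Fintype.piFinset_univ] at this
    rw [← this]
    simp [h]

/-! ## Triangularization with random inactivations -/

/-- The neighbours of output symbol `j` in the reduced graph with active input symbols `A`. -/
def reducedNbrs {k m : ℕ} (G : Graph k m) (A : Finset (Fin k)) (j : Fin m) : Finset (Fin k) :=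
  G j ∩ A

/-- The ripple: output symbols of reduced degree one. -/
def ripple {k m : ℕ} (G : Graph k m) (A : Finset (Fin k)) : Finset (Fin m) :=
  Finset.univ.filter fun j => (reducedNbrs G A j).card = 1

/-- The cloud: output symbols of reduced degree at least two. -/
def cloud {k m : ℕ} (G : Graph k m) (A : Finset (Fin k)) : Finset (Fin m) :=
  Finset.univ.filter fun j => 2 ≤ (reducedNbrs G A j).card

/-- The input symbols that are still active and those already marked as inactive; all the other
input symbols are resolvable. -/
@[ext]
structure DecoderState (k : ℕ) where
  active : Finset (Fin k)
  inactive : Finset (Fin k)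

/-- One step of triangularization. If the ripple is not empty, a uniformly chosen ripple element is
selected and its only active neighbour becomes resolvable. If the ripple is empty, a uniformly
chosen active input symbol becomes inactive. (With no active input symbol, nothing is left to do.) -/
def step {k m : ℕ} (G : Graph k m) (s : DecoderState k) : PMF (DecoderState k) :=
  if h : (ripple G s.active).Nonempty then
    (PMF.uniformOfFinset (ripple G s.active) h).map fun j =>
      ⟨s.active \ reducedNbrs G s.active j, s.inactive⟩
  else if h' : s.active.Nonempty then
    (PMF.uniformOfFinset s.active h').map fun v =>
      ⟨s.active.erase v, insert v s.inactive⟩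
  else PMF.pure s

/-- The law of the sequence of decoder states after `t` steps of triangularization. The state after
`i` steps is stored at index `u = k - i`, the number of input symbols active at that time, so that
the initial state (all input symbols active) has index `k`. Indices which are not yet reached hold
the initial state. -/
def trajectoryLaw {k m : ℕ} (G : Graph k m) : ℕ → PMF (ℕ → DecoderState k)
  | 0 => PMF.pure fun _ => ⟨Finset.univ, ∅⟩
  | t + 1 => (trajectoryLaw G t).bind fun h =>
      (step G (h (k - t))).map fun s => Function.update h (k - (t + 1)) s

/-- An outcome of the whole experiment: the code graph and the sequence of decoder states. -/
structure Outcome (k m : ℕ) where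
  graph : Graph k m
  state : ℕ → DecoderState k

instance (k m : ℕ) : MeasurableSpace (Outcome k m) := ⊤

/-- The probability measure of the experiment: draw a code graph, then run all `k` steps of the
triangularization procedure on it. -/
def law (k m : ℕ) (Ω : PMF ℕ) : MeasureTheory.Measure (Outcome k m) :=
  ((graphLaw k m Ω).bind fun G =>
    (trajectoryLaw G k).map fun h => (⟨G, h⟩ : Outcome k m)).toMeasure

namespace Outcome

variable {k m : ℕ}

/-- The ripple when `u` input symbols are active. -/
def rippleAt (ω : Outcome k m) (u : ℕ) : Finset (Fin m) := ripple ω.graph (ω.state u).active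

/-- The cloud when `u` input symbols are active. -/
def cloudAt (ω : Outcome k m) (u : ℕ) : Finset (Fin m) := cloud ω.graph (ω.state u).active

/-- The state `S_u = (C_u, R_u)`: the cardinalities of cloud and ripple. -/
def S (ω : Outcome k m) (u : ℕ) : ℕ × ℕ := ((ω.cloudAt u).card, (ω.rippleAt u).card)

/-- The number of output symbols that leave the cloud and enter the ripple in the transition from
`u` to `u - 1` active input symbols. -/
def moves (ω : Outcome k m) (u : ℕ) : ℕ := (ω.cloudAt u ∩ ω.rippleAt (u - 1)).card

/-- The number of output symbols that leave the ripple in the transition from `u` to `u - 1`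
active input symbols. -/
def departures (ω : Outcome k m) (u : ℕ) : ℕ := (ω.rippleAt u \ ω.rippleAt (u - 1)).card

/-- The number of inactivations performed in all `k` steps. -/
def numInactivations (ω : Outcome k m) : ℕ := (ω.state 0).inactive.card

end Outcome

/-! ## The closed-form probabilities -/

/-- The real number `Ω_d`. -/
def wt (Ω : PMF ℕ) (d : ℕ) : ℝ := (Ω d).toReal

/-- Closed form for the probability that an output symbol is in the cloud at `u` and in the ripple
at `u - 1`. -/
def cloudToRippleProb (k dMax : ℕ) (Ω : PMF ℕ) (u : ℕ) : ℝ :=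
  ∑ d ∈ Finset.Icc 2 dMax,
    wt Ω d * ((d : ℝ) / k) * ((d : ℝ) - 1) * (((u : ℝ) - 1) / ((k : ℝ) - 1)) *
      (((k - u).choose (d - 2) : ℝ) / ((k - 2).choose (d - 2) : ℝ))

/-- Closed form for the probability that an output symbol is in the cloud at `u`. -/
def cloudProb (k dMax : ℕ) (Ω : PMF ℕ) (u : ℕ) : ℝ :=
  1 - ∑ d ∈ Finset.Icc 1 dMax,
    wt Ω d * ((u : ℝ) * (((k - u).choose (d - 1) : ℝ) / (k.choose d : ℝ)) +
      ((k - u).choose d : ℝ) / (k.choose d : ℝ))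

/-- The probability `p_u` that a cloud symbol enters the ripple in the transition from `u` to
`u - 1` (equal to `0` when the cloud is almost surely empty). -/
def p (k dMax : ℕ) (Ω : PMF ℕ) (u : ℕ) : ℝ :=
  cloudToRippleProb k dMax Ω u / cloudProb k dMax Ω u

/-- The binomial probability of `b` successes in `n` trials with success probability `q`. -/
def binomialProb (n : ℕ) (q : ℝ) (b : ℕ) : ℝ := (n.choose b : ℝ) * q ^ b * (1 - q) ^ (n - b)

/-- The probability that `a` output symbols leave a ripple of size `r` when `u` input symbols are
active: `a - 1` is binomial with parameters `r - 1` and `1 / u` when `r > 0`, and `a = 0` when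
`r = 0`. -/
def departureProb (u r a : ℕ) : ℝ :=
  if r = 0 then (if a = 0 then 1 else 0)
  else if 1 ≤ a then binomialProb (r - 1) (1 / (u : ℝ)) (a - 1)
  else 0

/-- The probability of the transition from state `s` at `u` to state `s'` at `u - 1`: with `b`
moves from the cloud to the ripple and `a` departures from the ripple, the state
`(c, r)` becomes `(c - b, r - a + b)`. -/
def transProb (k dMax : ℕ) (Ω : PMF ℕ) (u : ℕ) (s s' : ℕ × ℕ) : ℝ :=
  ∑ b ∈ Finset.range (s.1 + 1), ∑ a ∈ Finset.range (s.2 + 1),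
    if s' = (s.1 - b, s.2 - a + b) then
      binomialProb s.1 (p k dMax Ω u) b * departureProb u s.2 a
    else 0

/-- The event that the chain follows the path `σ` from the start down to `u` active symbols. -/
def history (k m u : ℕ) (σ : ℕ → ℕ × ℕ) : Set (Outcome k m) :=
  {ω | ∀ w, u ≤ w → w ≤ k → ω.S w = σ w}

end LT

end

/-!
The run and the graph are summed over jointly. Given the graph `G`, the run is a Markov chain on
active sets: from `A` the symbol `v ∈ A` stops being active with probability `pickProb G A v`. Hence
the probability of an event on the past, the active set `A` at `u` and the next symbol `v` is a sum
of terms `P(G) * histWeight G B t A * pickProb G A v`, where `histWeight` is the conditional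
probability, given `G`, of reaching `A` with the prescribed past (`law_real_pastEvent_inter`).

The central fact is a principle of deferred decisions (`histWeight_congr`): `histWeight G B t A`
depends on `G` only through the profiles of the neighbour sets at `A`. A set with at least two
elements in `A` has not influenced the run, so its profile is blank; any other set has as its
profile its elements outside `A` and the number of those inside. Under the i.i.d. law of the
neighbour sets, the graphs with given profiles form a product space on which each cloud symbol has
the original law conditioned on being in the cloud, and each ripple symbol has a uniform active
neighbour. When `v` stops being active, a cloud symbol moves to the ripple if it has exactly two
active neighbours, one of them `v`; by exchangeability this has probability `p_u` for every `v`. A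
ripple symbol departs if its neighbour is `v`, which has probability `1 / u` for those that were not
chosen. So on each class moves and departures are independent and binomial
(`sum_profileClass_step`, through `sum_piFinset_card_filter`), with parameters that depend on the
class only through the sizes of cloud and ripple; summing over the classes gives the conditional law
given any past of the sizes, the Markov property and the recursion.

For the unconditional law of one output symbol `j`, observe that while `j` is in the cloud the run
is the same as if `j` were attached to all input symbols. The neighbour set of `j` may therefore be
drawn independently of the run (`law_real_of_cloud`), and the closed forms count subsets. Finally the
number of inactivations is the number of steps that start with an empty ripple, and its expectation
follows by linearity.
-/

noncomputable section

namespace LT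

variable {k m : ℕ}

/-! ### One step of triangularization -/

/-- The pair (cloud size, ripple size) of the reduced graph with active input symbols `A`. -/
def sizes (G : Graph k m) (A : Finset (Fin k)) : ℕ × ℕ := ((cloud G A).card, (ripple G A).card)

/-- The probability that `v` is the input symbol that stops being active when the active ones are
`A`: the proportion of ripple elements attached to `v`, or `1 / |A|` if the ripple is empty. It
describes both kinds of steps at once. -/
def pickProb (G : Graph k m) (A : Finset (Fin k)) (v : Fin k) : ℝ :=
  if (ripple G A).Nonempty then
    (((ripple G A).filter fun j => v ∈ G j).card : ℝ) / ((ripple G A).card : ℝ)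
  else 1 / (A.card : ℝ)

lemma mem_ripple {G : Graph k m} {A : Finset (Fin k)} {j : Fin m} :
    j ∈ ripple G A ↔ (G j ∩ A).card = 1 := by
  rw [ripple, Finset.mem_filter]
  simp [reducedNbrs]

lemma mem_cloud {G : Graph k m} {A : Finset (Fin k)} {j : Fin m} :
    j ∈ cloud G A ↔ 2 ≤ (G j ∩ A).card := by
  rw [cloud, Finset.mem_filter]
  simp [reducedNbrs]

lemma exists_reducedNbrs_eq_singleton {G : Graph k m} {A : Finset (Fin k)} {j : Fin m}
    (hj : j ∈ ripple G A) : ∃ v ∈ A, reducedNbrs G A j = {v} := by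
  obtain ⟨v, hv⟩ := Finset.card_eq_one.1 (mem_ripple.1 hj)
  have : v ∈ G j ∩ A := by rw [hv]; simp
  exact ⟨v, (Finset.mem_inter.1 this).2, hv⟩

lemma pickProb_nonneg (G : Graph k m) (A : Finset (Fin k)) (v : Fin k) : 0 ≤ pickProb G A v := by
  unfold pickProb
  split_ifs <;> positivity

lemma mem_support_step {G : Graph k m} {s s' : DecoderState k} (hs : s.active.Nonempty)
    (h : s' ∈ (step G s).support) :
    ∃ v ∈ s.active, s'.active = s.active.erase v ∧
      s'.inactive = if (ripple G s.active).Nonempty then s.inactive else insert v s.inactive := by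
  unfold step at h
  split_ifs at h with h1
  · simp only [PMF.support_map, Set.mem_image, PMF.mem_support_uniformOfFinset_iff] at h
    obtain ⟨j, hj, rfl⟩ := h
    obtain ⟨v, hv, hjv⟩ := exists_reducedNbrs_eq_singleton hj
    exact ⟨v, hv, by simp [hjv, Finset.sdiff_singleton_eq_erase], by simp [h1]⟩
  · simp only [PMF.support_map, Set.mem_image, PMF.mem_support_uniformOfFinset_iff] at h
    obtain ⟨v, hv, rfl⟩ := h
    exact ⟨v, hv, rfl, by simp [h1]⟩

open scoped Classical in
/-- `pickProb` is the law of the symbol that stops being active, whether or not the ripple is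
empty. -/
lemma step_toOuterMeasure (G : Graph k m) (s : DecoderState k) (hs : s.active.Nonempty)
    (Ψ : Finset (Fin k) → Prop) :
    (step G s).toOuterMeasure {s' | Ψ s'.active} =
      ENNReal.ofReal (∑ v ∈ s.active, if Ψ (s.active.erase v) then pickProb G s.active v else 0) := by
  set A := s.active with hA
  unfold step
  split_ifs with h1
  · have hpos : (0 : ℝ) < (ripple G A).card := by exact_mod_cast h1.card_pos
    rw [PMF.toOuterMeasure_map_apply, PMF.toOuterMeasure_uniformOfFinset_apply]
    have key : (∑ v ∈ A, if Ψ (A.erase v) then pickProb G A v else 0) =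
        (((ripple G A).filter fun j => Ψ (A \ reducedNbrs G A j)).card : ℝ) /
          (ripple G A).card := by
      have h2 : ∀ v ∈ A, (if Ψ (A.erase v) then pickProb G A v else 0) =
          ∑ j ∈ ripple G A,
            if v ∈ G j then (if Ψ (A \ reducedNbrs G A j) then (1 : ℝ) / (ripple G A).card else 0)
            else 0 := by
        intro v hv
        have h3 : ∀ j ∈ ripple G A,
            (if v ∈ G j then (if Ψ (A \ reducedNbrs G A j) then (1 : ℝ) / (ripple G A).card else 0)
              else 0) =
            if v ∈ G j then (if Ψ (A.erase v) then (1 : ℝ) / (ripple G A).card else 0)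
              else 0 := by
          intro j hj
          split_ifs with h4 h5 h6 h6 <;> try rfl
          all_goals
            exfalso
            obtain ⟨w, hw, hjw⟩ := exists_reducedNbrs_eq_singleton hj
            have : v ∈ reducedNbrs G A j := Finset.mem_inter.2 ⟨h4, hv⟩
            rw [hjw, Finset.mem_singleton] at this
            subst this
            rw [hjw, Finset.sdiff_singleton_eq_erase] at h5
            tauto
        rw [Finset.sum_congr rfl h3]
        unfold pickProb
        rw [if_pos h1, ← Finset.sum_filter, Finset.sum_const, nsmul_eq_mul]
        split_ifs
        · ring
        · ring
      rw [Finset.sum_congr rfl h2, Finset.sum_comm]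
      have h4 : ∀ j ∈ ripple G A, (∑ v ∈ A, if v ∈ G j then
            (if Ψ (A \ reducedNbrs G A j) then (1 : ℝ) / (ripple G A).card else 0) else 0) =
          if Ψ (A \ reducedNbrs G A j) then (1 : ℝ) / (ripple G A).card else 0 := by
        intro j hj
        rw [← Finset.sum_filter, Finset.sum_const, Finset.filter_mem_eq_inter, Finset.inter_comm,
          mem_ripple.1 hj, one_smul]
      rw [Finset.sum_congr rfl h4, ← Finset.sum_filter, Finset.sum_const, nsmul_eq_mul]
      ring
    rw [key, ENNReal.ofReal_div_of_pos hpos, ENNReal.ofReal_natCast, ENNReal.ofReal_natCast]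
    rfl
  · have hpos : (0 : ℝ) < A.card := by exact_mod_cast hs.card_pos
    rw [PMF.toOuterMeasure_map_apply, PMF.toOuterMeasure_uniformOfFinset_apply]
    have key : (∑ v ∈ A, if Ψ (A.erase v) then pickProb G A v else 0) =
        ((A.filter fun v => Ψ (A.erase v)).card : ℝ) / A.card := by
      rw [← Finset.sum_filter]
      unfold pickProb
      have h1' : ¬(ripple G A).Nonempty := h1
      simp only [if_neg h1', Finset.sum_const, nsmul_eq_mul]
      ring
    rw [key, ENNReal.ofReal_div_of_pos hpos, ENNReal.ofReal_natCast, ENNReal.ofReal_natCast]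
    rfl

/-! ### Trajectories -/

lemma mem_support_trajectoryLaw {G : Graph k m} {t : ℕ} (ht : t ≤ k) {h : ℕ → DecoderState k}
    (hh : h ∈ (trajectoryLaw G t).support) :
    h k = ⟨Finset.univ, ∅⟩ ∧ ∀ i < t, h (k - (i + 1)) ∈ (step G (h (k - i))).support := by
  induction t generalizing h with
  | zero =>
    simp only [trajectoryLaw, PMF.support_pure, Set.mem_singleton_iff] at hh
    subst hh
    simp
  | succ t ih =>
    simp only [trajectoryLaw, PMF.mem_support_bind_iff, PMF.support_map, Set.mem_image] at hh
    obtain ⟨h₀, hh₀, s, hs, rfl⟩ := hh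
    obtain ⟨h1, h2⟩ := ih (by omega) hh₀
    refine ⟨by rw [Function.update_of_ne (by omega), h1], fun i hi => ?_⟩
    rw [Function.update_of_ne (a := k - i) (by omega)]
    rcases Nat.lt_succ_iff_lt_or_eq.1 hi with hi' | rfl
    · rw [Function.update_of_ne (by omega)]
      exact h2 i hi'
    · rw [Function.update_self]
      exact hs

lemma card_active_of_mem_support {G : Graph k m} {t : ℕ} (ht : t ≤ k) {h : ℕ → DecoderState k}
    (hh : h ∈ (trajectoryLaw G t).support) :
    ∀ i ≤ t, (h (k - i)).active.card = k - i := by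
  obtain ⟨h1, h2⟩ := mem_support_trajectoryLaw ht hh
  intro i
  induction i with
  | zero => intro _; simp [h1]
  | succ i ih =>
    intro hi
    have h3 := ih (by omega)
    have hne : (h (k - i)).active.Nonempty := by
      rw [← Finset.card_pos]; omega
    obtain ⟨v, hv, h4, -⟩ := mem_support_step hne (h2 i (by omega))
    rw [h4, Finset.card_erase_of_mem hv]
    omega

lemma trajectoryLaw_succ_toOuterMeasure (G : Graph k m) (t : ℕ) (E : Set (ℕ → DecoderState k)) :
    (trajectoryLaw G (t + 1)).toOuterMeasure E = ∑' h, trajectoryLaw G t h *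
      (step G (h (k - t))).toOuterMeasure {s | Function.update h (k - (t + 1)) s ∈ E} := by
  rw [trajectoryLaw, PMF.toOuterMeasure_bind_apply]
  simp_rw [PMF.toOuterMeasure_map_apply]
  rfl

lemma toOuterMeasure_univ {α : Type*} (P : PMF α) : P.toOuterMeasure Set.univ = 1 := by
  rw [PMF.toOuterMeasure_apply]; simp

lemma toOuterMeasure_ne_top {α : Type*} (P : PMF α) (E : Set α) : P.toOuterMeasure E ≠ ⊤ :=
  ne_top_of_le_ne_top ENNReal.one_ne_top
    ((P.toOuterMeasure.mono (Set.subset_univ E)).trans (toOuterMeasure_univ P).le)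

/-- Later steps do not change the probability of an event that concerns the first `t` steps. -/
lemma trajectoryLaw_toOuterMeasure_of_le (G : Graph k m) {t t' : ℕ} (htt' : t ≤ t') (ht' : t' ≤ k)
    (E : Set (ℕ → DecoderState k))
    (hE : ∀ h s i, i < k - t → (Function.update h i s ∈ E ↔ h ∈ E)) :
    (trajectoryLaw G t').toOuterMeasure E = (trajectoryLaw G t).toOuterMeasure E := by
  classical
  induction t', htt' using Nat.le_induction with
  | base => rfl
  | succ n hn ih =>
    rw [← ih (by omega), trajectoryLaw_succ_toOuterMeasure, PMF.toOuterMeasure_apply]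
    refine tsum_congr fun h => ?_
    have : {s | Function.update h (k - (n + 1)) s ∈ E} = if h ∈ E then Set.univ else ∅ := by
      ext s
      simp only [Set.mem_ofPred_eq, hE h s (k - (n + 1)) (by omega)]
      split_ifs with h1 <;> simp [h1]
    rw [this]
    by_cases h1 : h ∈ E <;> simp [h1, toOuterMeasure_univ]

/-- The trajectories whose pairs of cloud and ripple sizes lie in the prescribed sets `B w` from
the start down to index `u`. -/
def sizeEvent (G : Graph k m) (B : ℕ → Set (ℕ × ℕ)) (u : ℕ) : Set (ℕ → DecoderState k) :=
  {h | ∀ w, u ≤ w → w ≤ k → sizes G (h w).active ∈ B w}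

/-- The conditional probability, given the graph, that after `t` steps the active set is `A` and
the sizes have stayed in the sets `B w`. -/
def histWeight (G : Graph k m) (B : ℕ → Set (ℕ × ℕ)) (t : ℕ) (A : Finset (Fin k)) : ℝ :=
  ((trajectoryLaw G t).toOuterMeasure
    {h | h ∈ sizeEvent G B (k - t) ∧ (h (k - t)).active = A}).toReal

lemma histWeight_eq_zero_of_card_ne (G : Graph k m) (B : ℕ → Set (ℕ × ℕ)) {t : ℕ} (ht : t ≤ k)
    {A : Finset (Fin k)} (hA : A.card ≠ k - t) : histWeight G B t A = 0 := by
  have : (trajectoryLaw G t).toOuterMeasure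
      {h | h ∈ sizeEvent G B (k - t) ∧ (h (k - t)).active = A} = 0 := by
    rw [PMF.toOuterMeasure_apply_eq_zero_iff, Set.disjoint_left]
    rintro h hh ⟨-, rfl⟩
    exact hA (card_active_of_mem_support ht hh t le_rfl)
  rw [histWeight, this]; rfl

lemma histWeight_eq_zero_of_sizes_not_mem (G : Graph k m) (B : ℕ → Set (ℕ × ℕ)) (t : ℕ)
    {A : Finset (Fin k)} (hA : sizes G A ∉ B (k - t)) : histWeight G B t A = 0 := by
  have : {h : ℕ → DecoderState k | h ∈ sizeEvent G B (k - t) ∧ (h (k - t)).active = A} = ∅ := by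
    rw [Set.eq_empty_iff_forall_notMem]
    rintro h ⟨h1, rfl⟩
    exact hA (h1 _ le_rfl (Nat.sub_le _ _))
  rw [histWeight, this]; simp

open scoped Classical in
/-- The probability, given the graph, of an event on the past sizes, the active set after `t` steps
and the active set one step later. -/
lemma trajectoryLaw_succ_sizeEvent (G : Graph k m) (B : ℕ → Set (ℕ × ℕ)) {t : ℕ} (ht : t < k)
    (Ψ : Finset (Fin k) → Finset (Fin k) → Prop) :
    ((trajectoryLaw G (t + 1)).toOuterMeasure {h | h ∈ sizeEvent G B (k - t) ∧
        Ψ (h (k - t)).active (h (k - (t + 1))).active}).toReal =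
      ∑ A, histWeight G B t A *
        ∑ v ∈ A, if Ψ A (A.erase v) then pickProb G A v else 0 := by
  set e : Finset (Fin k) → ℝ := fun A => ∑ v ∈ A, if Ψ A (A.erase v) then pickProb G A v else 0
    with he
  have he0 : ∀ A, 0 ≤ e A := fun A => Finset.sum_nonneg fun v _ => by
    split_ifs
    · exact pickProb_nonneg _ _ _
    · exact le_rfl
  have h1 : (trajectoryLaw G (t + 1)).toOuterMeasure {h | h ∈ sizeEvent G B (k - t) ∧
        Ψ (h (k - t)).active (h (k - (t + 1))).active} =
      ∑ A, (trajectoryLaw G t).toOuterMeasure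
        {h | h ∈ sizeEvent G B (k - t) ∧ (h (k - t)).active = A} * ENNReal.ofReal (e A) := by
    rw [trajectoryLaw_succ_toOuterMeasure]
    simp_rw [PMF.toOuterMeasure_apply, ← ENNReal.tsum_mul_right]
    rw [← Summable.tsum_finsetSum fun _ _ => ENNReal.summable]
    refine tsum_congr fun h => ?_
    -- on the support the active set is not empty, so that `step_toOuterMeasure` applies
    by_cases hsupp : h ∈ (trajectoryLaw G t).support
    swap
    · have : trajectoryLaw G t h = 0 := by rwa [← PMF.apply_eq_zero_iff] at hsupp
      simp [Set.indicator_apply, this]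
    have hne : (h (k - t)).active.Nonempty := by
      rw [← Finset.card_pos, card_active_of_mem_support ht.le hsupp t le_rfl]; omega
    rw [Finset.sum_eq_single (h (k - t)).active]
    · by_cases hB : h ∈ sizeEvent G B (k - t)
      · rw [Set.indicator_of_mem (by exact ⟨hB, rfl⟩)]
        rw [he]
        dsimp only
        rw [← step_toOuterMeasure G (h (k - t)) hne (Ψ (h (k - t)).active)]
        rw [← PMF.toOuterMeasure_apply]
        congr 1
        refine congrArg _ (Set.ext fun s => ?_)
        have h2 : ∀ w, k - t ≤ w → Function.update h (k - (t + 1)) s w = h w := fun w hw =>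
          Function.update_of_ne (by omega) _ _
        have h3 : Function.update h (k - (t + 1)) s ∈ sizeEvent G B (k - t) := by
          intro w hw hw'
          rw [h2 w hw]
          exact hB w hw hw'
        simp only [Set.mem_ofPred_eq, h3, true_and, h2 _ le_rfl, Function.update_self]
      · rw [Set.indicator_of_notMem (by rintro ⟨h', -⟩; exact hB h'), zero_mul]
        have : {s | Function.update h (k - (t + 1)) s ∈ {h | h ∈ sizeEvent G B (k - t) ∧
            Ψ (h (k - t)).active (h (k - (t + 1))).active}} = ∅ := by
          rw [Set.eq_empty_iff_forall_notMem]
          rintro s ⟨h', -⟩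
          refine hB fun w hw hw' => ?_
          have := h' w hw hw'
          rwa [Function.update_of_ne (by omega)] at this
        rw [this]; simp
    · intro A _ hA
      rw [Set.indicator_of_notMem (by rintro ⟨-, h'⟩; exact hA h'.symm), zero_mul]
    · simp
  rw [h1, ENNReal.toReal_sum fun A _ =>
    ENNReal.mul_ne_top (toOuterMeasure_ne_top _ _) ENNReal.ofReal_ne_top]
  refine Finset.sum_congr rfl fun A _ => ?_
  rw [ENNReal.toReal_mul, ENNReal.toReal_ofReal (he0 A)]
  rfl

open scoped Classical in
lemma histWeight_succ (G : Graph k m) (B : ℕ → Set (ℕ × ℕ)) {t : ℕ} (ht : t < k)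
    (A' : Finset (Fin k)) :
    histWeight G B (t + 1) A' = if sizes G A' ∈ B (k - (t + 1)) then
      ∑ A, histWeight G B t A * ∑ v ∈ A, if A.erase v = A' then pickProb G A v else 0 else 0 := by
  split_ifs with hA'
  · have key := trajectoryLaw_succ_sizeEvent G B ht fun _ A => A = A'
    refine Eq.trans ?_ (key.trans (by congr!))
    rw [histWeight]
    refine congrArg _ (congrArg _ (Set.ext fun h => ?_))
    refine ⟨fun ⟨h1, h2⟩ => ⟨fun w hw hw' => h1 w (by omega) hw', h2⟩,
      fun ⟨h1, h2⟩ => ⟨fun w hw hw' => ?_, h2⟩⟩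
    by_cases hwt : k - t ≤ w
    · exact h1 w hwt hw'
    · obtain rfl : w = k - (t + 1) := by omega
      rwa [h2]
  · exact histWeight_eq_zero_of_sizes_not_mem G B _ hA'

lemma sum_pickProb (G : Graph k m) {A : Finset (Fin k)} (hA : A.Nonempty) :
    ∑ v ∈ A, pickProb G A v = 1 := by
  have h := step_toOuterMeasure G ⟨A, ∅⟩ hA fun _ => True
  simp only [Set.ofPred_true, toOuterMeasure_univ, if_true] at h
  have h0 : 0 ≤ ∑ v ∈ A, pickProb G A v := Finset.sum_nonneg fun v _ => pickProb_nonneg _ _ _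
  rw [← ENNReal.toReal_ofReal h0, ← h]
  rfl

lemma sum_histWeight_univ (G : Graph k m) (t : ℕ) :
    ∑ A, histWeight G (fun _ => Set.univ) t A = 1 := by
  classical
  unfold histWeight
  rw [← ENNReal.toReal_sum fun A _ => toOuterMeasure_ne_top _ _]
  simp_rw [PMF.toOuterMeasure_apply]
  rw [← Summable.tsum_finsetSum fun _ _ => ENNReal.summable]
  have : ∀ h : ℕ → DecoderState k, ∑ A, Set.indicator
      {h | h ∈ sizeEvent G (fun _ => Set.univ) (k - t) ∧ (h (k - t)).active = A}
      (trajectoryLaw G t) h = trajectoryLaw G t h := by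
    intro h
    rw [Finset.sum_eq_single (h (k - t)).active]
    · exact Set.indicator_of_mem (by exact ⟨fun _ _ _ => trivial, rfl⟩) _
    · intro A _ hA
      exact Set.indicator_of_notMem (by rintro ⟨-, h'⟩; exact hA h'.symm) _
    · simp
  simp_rw [this, PMF.tsum_coe]
  rfl

/-! ### The law of the experiment -/

/-- The probability that the neighbour set of an output symbol is `S`, as a real number. -/
def nbrProb (k : ℕ) (Ω : PMF ℕ) (S : Finset (Fin k)) : ℝ := (nbrLaw k Ω S).toReal

lemma nbrProb_nonneg (Ω : PMF ℕ) (S : Finset (Fin k)) : 0 ≤ nbrProb k Ω S := ENNReal.toReal_nonneg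

lemma sum_nbrProb (k : ℕ) (Ω : PMF ℕ) : ∑ S, nbrProb k Ω S = 1 := by
  unfold nbrProb
  rw [← ENNReal.toReal_sum fun S _ => PMF.apply_ne_top _ _,
    ← tsum_fintype (L := .unconditional _), PMF.tsum_coe]
  rfl

lemma sum_prod_nbrProb (k m : ℕ) (Ω : PMF ℕ) :
    ∑ G : Graph k m, ∏ j, nbrProb k Ω (G j) = 1 := by
  have h := Finset.prod_univ_sum (ι := Fin m) (κ := fun _ => Finset (Fin k))
      (fun _ => Finset.univ) (fun _ S => nbrProb k Ω S)
  rw [Fintype.piFinset_univ] at h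
  rw [← h]
  simp [sum_nbrProb]

lemma graphLaw_toReal (Ω : PMF ℕ) (G : Graph k m) :
    (graphLaw k m Ω G).toReal = ∏ j, nbrProb k Ω (G j) := by
  rw [graphLaw, PMF.ofFintype_apply, ENNReal.toReal_prod]
  rfl

instance isProbabilityMeasure_law (Ω : PMF ℕ) : MeasureTheory.IsProbabilityMeasure (law k m Ω) := by
  unfold law; infer_instance

lemma measurableSet_outcome (E : Set (Outcome k m)) : MeasurableSet E := trivial

lemma law_real_apply (Ω : PMF ℕ) (E : Set (Outcome k m)) :
    (law k m Ω).real E = ∑ G : Graph k m, (∏ j, nbrProb k Ω (G j)) *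
      ((trajectoryLaw G k).toOuterMeasure {h | (⟨G, h⟩ : Outcome k m) ∈ E}).toReal := by
  rw [MeasureTheory.measureReal_def, law,
    PMF.toMeasure_apply_eq_toOuterMeasure_apply _ (measurableSet_outcome E),
    PMF.toOuterMeasure_bind_apply, tsum_fintype,
    ENNReal.toReal_sum fun G _ => ENNReal.mul_ne_top (PMF.apply_ne_top _ _)
      (toOuterMeasure_ne_top _ _)]
  refine Finset.sum_congr rfl fun G _ => ?_
  rw [ENNReal.toReal_mul, graphLaw_toReal, PMF.toOuterMeasure_map_apply]
  rfl

/-- The outcomes whose pairs `S w` lie in the prescribed sets `B w` for all `w` from `k` down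
to `u`. -/
def pastEvent (k m u : ℕ) (B : ℕ → Set (ℕ × ℕ)) : Set (Outcome k m) :=
  {ω | ∀ w, u ≤ w → w ≤ k → ω.S w ∈ B w}

open scoped Classical in
/-- The probability of an event on the past up to `u` and the transition from `u` to `u - 1`: sum
over the graph, the active set `A` at `u` and the symbol `v` that stops being active. -/
lemma law_real_pastEvent_inter (Ω : PMF ℕ) {u : ℕ} (hu : 1 ≤ u) (huk : u ≤ k)
    (B : ℕ → Set (ℕ × ℕ)) (Ψ : Graph k m → Finset (Fin k) → Finset (Fin k) → Prop) :
    (law k m Ω).real (pastEvent k m u B ∩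
        {ω | Ψ ω.graph (ω.state u).active (ω.state (u - 1)).active}) =
      ∑ G : Graph k m, (∏ j, nbrProb k Ω (G j)) * ∑ A, histWeight G B (k - u) A *
        ∑ v ∈ A, if Ψ G A (A.erase v) then pickProb G A v else 0 := by
  rw [law_real_apply]
  refine Finset.sum_congr rfl fun G _ => ?_
  rw [← trajectoryLaw_succ_sizeEvent G B (by omega) (Ψ G)]
  have h1 : k - (k - u) = u := by omega
  have h2 : k - (k - u + 1) = u - 1 := by omega
  rw [h1, h2, ← trajectoryLaw_toOuterMeasure_of_le G (t := k - u + 1) (t' := k) (by omega) le_rfl]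
  · rfl
  · intro h s i hi
    have h3 : ∀ w, u - 1 ≤ w → Function.update h i s w = h w := fun w hw =>
      Function.update_of_ne (by omega) _ _
    have h4 : Function.update h i s ∈ sizeEvent G B u ↔ h ∈ sizeEvent G B u := by
      refine forall_congr' fun w => forall_congr' fun hw => ?_
      rw [h3 w (by omega)]
    change (_ ∧ _) ↔ (_ ∧ _)
    rw [h4, h3 _ le_rfl, h3 u (by omega)]

lemma law_real_pastEvent (Ω : PMF ℕ) {u : ℕ} (hu : 1 ≤ u) (huk : u ≤ k) (B : ℕ → Set (ℕ × ℕ)) :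
    (law k m Ω).real (pastEvent k m u B) =
      ∑ G : Graph k m, (∏ j, nbrProb k Ω (G j)) * ∑ A, histWeight G B (k - u) A := by
  have h := law_real_pastEvent_inter (m := m) Ω hu huk B fun _ _ _ => True
  simp only [Set.ofPred_true, Set.inter_univ, if_true] at h
  rw [h]
  refine Finset.sum_congr rfl fun G _ => ?_
  congr 1
  refine Finset.sum_congr rfl fun A _ => ?_
  by_cases hA : A.card = u
  · rw [sum_pickProb G (Finset.card_pos.1 (by omega)), mul_one]
  · rw [histWeight_eq_zero_of_card_ne G B (by omega) (by omega), zero_mul]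

/-! ### Almost sure properties of the runs -/

/-- The outcome is a possible one: the graph has positive probability, and the states form a run of
the procedure on it. The field `active_card` follows from the two fields around it. -/
structure IsRun (Ω : PMF ℕ) (ω : Outcome k m) : Prop where
  graph : ∀ j, nbrLaw k Ω (ω.graph j) ≠ 0
  init : ω.state k = ⟨Finset.univ, ∅⟩
  active_card : ∀ u ≤ k, (ω.state u).active.card = u
  step : ∀ u, 1 ≤ u → u ≤ k → ω.state (u - 1) ∈ (step ω.graph (ω.state u)).support

lemma ae_isRun (Ω : PMF ℕ) : ∀ᵐ ω ∂(law k m Ω), IsRun Ω ω := by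
  rw [MeasureTheory.ae_iff, law, PMF.toMeasure_apply_eq_zero_iff _ (measurableSet_outcome _),
    Set.disjoint_left]
  intro ω hω
  simp only [PMF.mem_support_bind_iff, PMF.support_map, Set.mem_image] at hω
  obtain ⟨G, hG, h, hh, rfl⟩ := hω
  refine not_not.2 ⟨fun j hj => ?_, (mem_support_trajectoryLaw le_rfl hh).1, fun u hu => ?_,
    fun u hu huk => ?_⟩
  · rw [PMF.mem_support_iff, graphLaw, PMF.ofFintype_apply] at hG
    exact hG (Finset.prod_eq_zero (Finset.mem_univ j) hj)
  · have := card_active_of_mem_support le_rfl hh (k - u) (by omega)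
    rwa [show k - (k - u) = u by omega] at this
  · have := (mem_support_trajectoryLaw le_rfl hh).2 (k - u) (by omega)
    rwa [show k - (k - u) = u by omega, show k - (k - u + 1) = u - 1 by omega] at this

lemma IsRun.exists_erase {Ω : PMF ℕ} {ω : Outcome k m} (h : IsRun Ω ω) {u : ℕ} (hu : 1 ≤ u)
    (huk : u ≤ k) : ∃ v ∈ (ω.state u).active, (ω.state (u - 1)).active = (ω.state u).active.erase v ∧
      (ω.state (u - 1)).inactive = if (ω.rippleAt u).Nonempty then (ω.state u).inactive
        else insert v (ω.state u).inactive := by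
  refine mem_support_step (G := ω.graph) ?_ (h.step u hu huk)
  rw [← Finset.card_pos, h.active_card u huk]
  omega

lemma card_inter_erase (S A : Finset (Fin k)) {v : Fin k} (hv : v ∈ A) :
    (S ∩ A).card = (S ∩ A.erase v).card + if v ∈ S then 1 else 0 := by
  rw [Finset.inter_erase]
  split_ifs with h
  · rw [Finset.card_erase_add_one (Finset.mem_inter.2 ⟨h, hv⟩)]
  · rw [Finset.erase_eq_of_notMem (by simp [h]), add_zero]

lemma cloud_inter_ripple_erase (G : Graph k m) {A : Finset (Fin k)} {v : Fin k} (hv : v ∈ A) :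
    cloud G A ∩ ripple G (A.erase v) =
      (cloud G A).filter fun j => v ∈ G j ∧ (G j ∩ A).card = 2 := by
  ext j
  simp only [Finset.mem_inter, Finset.mem_filter, mem_cloud, mem_ripple]
  have := card_inter_erase (G j) A hv
  split_ifs at this with h
  · simp only [h, true_and]; omega
  · simp only [h, false_and, and_false, iff_false]; omega

lemma ripple_sdiff_ripple_erase (G : Graph k m) {A : Finset (Fin k)} {v : Fin k} (hv : v ∈ A) :
    ripple G A \ ripple G (A.erase v) = (ripple G A).filter fun j => v ∈ G j := by
  ext j
  simp only [Finset.mem_sdiff, Finset.mem_filter, mem_ripple]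
  have := card_inter_erase (G j) A hv
  split_ifs at this with h
  · simp only [h, and_true]; omega
  · simp only [h, and_false, iff_false]; omega

/-- A step moves some output symbols from the cloud to the ripple and lets some leave the ripple;
nothing else changes. -/
lemma sizes_erase (G : Graph k m) {A : Finset (Fin k)} {v : Fin k} (hv : v ∈ A) :
    sizes G (A.erase v) =
      ((sizes G A).1 - (cloud G A ∩ ripple G (A.erase v)).card,
        (sizes G A).2 - (ripple G A \ ripple G (A.erase v)).card +
          (cloud G A ∩ ripple G (A.erase v)).card) := by
  have h1 : cloud G (A.erase v) = cloud G A \ (cloud G A ∩ ripple G (A.erase v)) := by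
    ext j
    simp only [Finset.mem_sdiff, Finset.mem_inter, mem_ripple, mem_cloud]
    have := card_inter_erase (G j) A hv
    split_ifs at this <;> omega
  have h2 : ripple G (A.erase v) = (ripple G A \ (ripple G A \ ripple G (A.erase v))) ∪
      (cloud G A ∩ ripple G (A.erase v)) := by
    ext j
    simp only [Finset.mem_sdiff, Finset.mem_inter, Finset.mem_union, mem_ripple, mem_cloud]
    have := card_inter_erase (G j) A hv
    split_ifs at this <;> omega
  have h3 : Disjoint (ripple G A \ (ripple G A \ ripple G (A.erase v)))
      (cloud G A ∩ ripple G (A.erase v)) := by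
    rw [Finset.disjoint_left]
    intro j
    simp only [Finset.mem_sdiff, Finset.mem_inter, mem_ripple, mem_cloud]
    omega
  unfold sizes
  refine Prod.ext ?_ ?_
  · dsimp only
    conv_lhs => rw [h1]
    rw [Finset.card_sdiff_of_subset Finset.inter_subset_left]
  · dsimp only
    conv_lhs => rw [h2]
    rw [Finset.card_union_of_disjoint h3, Finset.card_sdiff_of_subset Finset.sdiff_subset]

lemma IsRun.S_sub_one {Ω : PMF ℕ} {ω : Outcome k m} (h : IsRun Ω ω) {u : ℕ} (hu : 1 ≤ u)
    (huk : u ≤ k) :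
    ω.S (u - 1) = ((ω.S u).1 - ω.moves u, (ω.S u).2 - ω.departures u + ω.moves u) := by
  obtain ⟨v, hv, hv', -⟩ := h.exists_erase hu huk
  have := sizes_erase ω.graph hv
  rw [← hv'] at this
  exact this

lemma IsRun.card_inactive {Ω : PMF ℕ} {ω : Outcome k m} (h : IsRun Ω ω) (i : ℕ) (hi : i ≤ k) :
    Disjoint (ω.state (k - i)).active (ω.state (k - i)).inactive ∧
    (ω.state (k - i)).inactive.card =
      ∑ u ∈ Finset.Ioc (k - i) k, if ω.rippleAt u = ∅ then 1 else 0 := by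
  induction i with
  | zero => simp [h.init]
  | succ i ih =>
    obtain ⟨ih1, ih2⟩ := ih (by omega)
    obtain ⟨v, hv, hv1, hv2⟩ := h.exists_erase (u := k - i) (by omega) (by omega)
    have hIoc : Finset.Ioc (k - (i + 1)) k = insert (k - i) (Finset.Ioc (k - i) k) := by
      ext x; simp only [Finset.mem_Ioc, Finset.mem_insert]; omega
    rw [hIoc, Finset.sum_insert (by simp), ← ih2, show k - (i + 1) = k - i - 1 by omega, hv1, hv2]
    by_cases hr : (ω.rippleAt (k - i)).Nonempty
    · rw [if_pos hr, if_neg hr.ne_empty]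
      exact ⟨ih1.mono_left (Finset.erase_subset _ _), by simp⟩
    · rw [if_neg hr, if_pos (Finset.not_nonempty_iff_eq_empty.1 hr),
        Finset.card_insert_of_notMem (Finset.disjoint_left.1 ih1 hv), add_comm]
      refine ⟨?_, rfl⟩
      rw [Finset.disjoint_insert_right]
      exact ⟨by simp, ih1.mono_left (Finset.erase_subset _ _)⟩

/-- The number of inactivations is the number of steps that start with an empty ripple. -/
lemma IsRun.numInactivations_eq {Ω : PMF ℕ} {ω : Outcome k m} (h : IsRun Ω ω) :
    ω.numInactivations = ∑ u ∈ Finset.Icc 1 k, if ω.rippleAt u = ∅ then 1 else 0 := by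
  have := (h.card_inactive k le_rfl).2
  rw [Nat.sub_self] at this
  exact this

lemma S_mem_range (ω : Outcome k m) (u : ℕ) :
    ω.S u ∈ Finset.range (m + 1) ×ˢ Finset.range (m + 1) := by
  rw [Finset.mem_product, Finset.mem_range, Finset.mem_range, Nat.lt_succ_iff, Nat.lt_succ_iff]
  have h1 := Finset.card_le_univ (ω.cloudAt u)
  have h2 := Finset.card_le_univ (ω.rippleAt u)
  rw [Fintype.card_fin] at h1 h2
  exact ⟨h1, h2⟩

lemma integrable_outcome (Ω : PMF ℕ) {f : Outcome k m → ℝ} {c : ℝ} (hf : ∀ ω, |f ω| ≤ c) :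
    MeasureTheory.Integrable f (law k m Ω) :=
  MeasureTheory.Integrable.of_bound (C := c)
    (Measurable.aestronglyMeasurable fun _ _ => measurableSet_outcome _) (MeasureTheory.ae_of_all _ hf)

lemma integrable_numInactivations (Ω : PMF ℕ) :
    MeasureTheory.Integrable (fun ω => (ω.numInactivations : ℝ)) (law k m Ω) := by
  refine integrable_outcome Ω (c := k) fun ω => ?_
  have h := Finset.card_le_univ (ω.state 0).inactive
  rw [Fintype.card_fin] at h
  rw [abs_of_nonneg (by positivity)]
  exact_mod_cast h

lemma integral_numInactivations (Ω : PMF ℕ) :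
    ∫ ω, (ω.numInactivations : ℝ) ∂(law k m Ω) =
      ∑ u ∈ Finset.Icc 1 k, ∑ c ∈ Finset.range (m + 1),
        (law k m Ω).real {ω | ω.S u = (c, 0)} := by
  have h1 : ∫ ω, (ω.numInactivations : ℝ) ∂(law k m Ω) =
      ∫ ω, ∑ u ∈ Finset.Icc 1 k, ∑ c ∈ Finset.range (m + 1),
        Set.indicator {ω : Outcome k m | ω.S u = (c, 0)} (fun _ => (1 : ℝ)) ω ∂(law k m Ω) := by
    refine MeasureTheory.integral_congr_ae ?_
    filter_upwards [ae_isRun Ω] with ω hω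
    rw [hω.numInactivations_eq]
    push_cast
    refine Finset.sum_congr rfl fun u _ => ?_
    have hmem := Finset.mem_product.1 (S_mem_range ω u)
    rw [Finset.sum_eq_single (ω.S u).1]
    · rw [Set.indicator_apply]
      refine if_congr ?_ rfl rfl
      rw [Set.mem_ofPred_eq, Prod.ext_iff, ← Finset.card_eq_zero]
      exact ⟨fun h => ⟨rfl, h⟩, fun h => h.2⟩
    · intro c _ hc
      refine Set.indicator_of_notMem (fun h => hc ?_) _
      exact congrArg Prod.fst h.symm
    · exact fun h => absurd hmem.1 h
  have hint : ∀ E : Set (Outcome k m),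
      MeasureTheory.Integrable (Set.indicator E fun _ => (1 : ℝ)) (law k m Ω) := fun E =>
    (MeasureTheory.integrable_const 1).indicator (measurableSet_outcome E)
  rw [h1, MeasureTheory.integral_finsetSum _ fun u _ =>
    MeasureTheory.integrable_finsetSum _ fun c _ => hint _]
  refine Finset.sum_congr rfl fun u _ => ?_
  rw [MeasureTheory.integral_finsetSum _ fun c _ => hint _]
  refine Finset.sum_congr rfl fun c _ => ?_
  rw [MeasureTheory.integral_indicator_const _ (measurableSet_outcome _), smul_eq_mul, mul_one]

/-! ### Binomial laws on finite product spaces -/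

/-- The indicator of `b` successes as a sum, over the possible sets of successes, of products with
one factor per coordinate. Such products can be summed one coordinate at a time. -/
lemma ite_card_filter_eq {ι : Type*} [DecidableEq ι] (C : Finset ι) (P : ι → Prop)
    [DecidablePred P] (b : ℕ) :
    (if (C.filter P).card = b then (1 : ℝ) else 0) =
      ∑ B ∈ Finset.powersetCard b C, ∏ j ∈ C,
        if j ∈ B then (if P j then 1 else 0) else (if P j then 0 else 1) := by
  have h : ∀ B ∈ Finset.powersetCard b C, (∏ j ∈ C,
      if j ∈ B then (if P j then (1 : ℝ) else 0) else (if P j then 0 else 1)) =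
      if C.filter P = B then 1 else 0 := by
    intro B hB
    have hBC := (Finset.mem_powersetCard.1 hB).1
    split_ifs with h1
    · refine Finset.prod_eq_one fun j hj => ?_
      by_cases hP : P j
      · simp [← h1, hj, hP]
      · simp [← h1, hP]
    · obtain ⟨j, hj⟩ : ∃ j ∈ C, ¬(P j ↔ j ∈ B) := by
        by_contra hcon
        push Not at hcon
        refine h1 (Finset.ext fun j => ?_)
        rw [Finset.mem_filter]
        exact ⟨fun h => (hcon j h.1).1 h.2, fun h => ⟨hBC h, (hcon j (hBC h)).2 h⟩⟩
      refine Finset.prod_eq_zero hj.1 ?_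
      by_cases hP : P j <;> by_cases hjB : j ∈ B <;> simp_all
  rw [Finset.sum_congr rfl h, Finset.sum_ite_eq]
  refine if_congr ?_ rfl rfl
  simp [Finset.mem_powersetCard, Finset.filter_subset]

lemma sum_powersetCard_prod_ite {ι : Type*} [DecidableEq ι] (C : Finset ι) (q : ℝ) (b : ℕ) :
    ∑ B ∈ Finset.powersetCard b C, ∏ j ∈ C, (if j ∈ B then q else 1 - q) =
      binomialProb C.card q b := by
  have h : ∀ B ∈ Finset.powersetCard b C, (∏ j ∈ C, (if j ∈ B then q else 1 - q)) =
      q ^ b * (1 - q) ^ (C.card - b) := by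
    intro B hB
    obtain ⟨hBC, hb⟩ := Finset.mem_powersetCard.1 hB
    rw [Finset.prod_ite, Finset.prod_const, Finset.prod_const, Finset.filter_mem_eq_inter,
      Finset.inter_eq_right.2 hBC, hb, Finset.filter_notMem_eq_sdiff,
      Finset.card_sdiff_of_subset hBC, hb]
  rw [Finset.sum_congr rfl h, Finset.sum_const, Finset.card_powersetCard, nsmul_eq_mul,
    binomialProb, mul_assoc]

open scoped Classical in
/-- Under a product weight, the numbers of coordinates in `C` satisfying `E` and of coordinates in
`R` satisfying `F` are independent and binomial, if each coordinate in `C` satisfies `E` with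
conditional probability `p` and each coordinate in `R` satisfies `F` with conditional
probability `q`. -/
lemma sum_piFinset_card_filter {ι X : Type*} [Fintype ι] [DecidableEq ι] (t : ι → Finset X)
    (w : ι → X → ℝ) (E F : X → Prop) {C R : Finset ι} (hCR : Disjoint C R) {p q : ℝ}
    (hC : ∀ j ∈ C, (∑ x ∈ t j, if E x then w j x else 0) = p * ∑ x ∈ t j, w j x)
    (hR : ∀ j ∈ R, (∑ x ∈ t j, if F x then w j x else 0) = q * ∑ x ∈ t j, w j x) (b a : ℕ) :
    ∑ G ∈ Fintype.piFinset t, (∏ j, w j (G j)) *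
        (if (C.filter fun j => E (G j)).card = b ∧ (R.filter fun j => F (G j)).card = a
          then 1 else 0) =
      binomialProb C.card p b * binomialProb R.card q a * ∏ j, ∑ x ∈ t j, w j x := by
  set φ : Finset ι → ι → X → ℝ := fun B j x =>
    if j ∈ B then (if E x then 1 else 0) else (if E x then 0 else 1) with hφ
  set ψ : Finset ι → ι → X → ℝ := fun B j x =>
    if j ∈ B then (if F x then 1 else 0) else (if F x then 0 else 1) with hψ
  have h1 : ∀ G : ι → X, (∏ j, w j (G j)) *
        (if (C.filter fun j => E (G j)).card = b ∧ (R.filter fun j => F (G j)).card = a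
          then 1 else 0) =
      ∑ B ∈ Finset.powersetCard b C, ∑ B' ∈ Finset.powersetCard a R,
        ∏ j, w j (G j) * ((if j ∈ C then φ B j (G j) else 1) *
          (if j ∈ R then ψ B' j (G j) else 1)) := by
    intro G
    have h2 : (if (C.filter fun j => E (G j)).card = b ∧ (R.filter fun j => F (G j)).card = a
          then (1 : ℝ) else 0) =
        (if (C.filter fun j => E (G j)).card = b then 1 else 0) *
          (if (R.filter fun j => F (G j)).card = a then 1 else 0) := by
      rw [ite_and]; split_ifs <;> simp
    rw [h2, ite_card_filter_eq C (fun j => E (G j)), ite_card_filter_eq R (fun j => F (G j)),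
      Finset.sum_mul_sum, Finset.mul_sum]
    refine Finset.sum_congr rfl fun B _ => ?_
    rw [Finset.mul_sum]
    refine Finset.sum_congr rfl fun B' _ => ?_
    rw [Finset.prod_mul_distrib, Finset.prod_mul_distrib, Fintype.prod_ite_mem,
      Fintype.prod_ite_mem]
  have hsplit : ∀ (P : X → Prop) (j : ι) (s : ℝ),
      (∑ x ∈ t j, if P x then w j x else 0) = s * ∑ x ∈ t j, w j x →
      (∑ x ∈ t j, if P x then 0 else w j x) = (1 - s) * ∑ x ∈ t j, w j x := by
    intro P j s hs
    have : (∑ x ∈ t j, if P x then w j x else 0) + (∑ x ∈ t j, if P x then 0 else w j x) =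
        ∑ x ∈ t j, w j x := by
      rw [← Finset.sum_add_distrib]
      exact Finset.sum_congr rfl fun x _ => by split_ifs <;> simp
    linarith
  have h3 : ∀ B B' : Finset ι, ∀ j, (∑ x ∈ t j, w j x * ((if j ∈ C then φ B j x else 1) *
          (if j ∈ R then ψ B' j x else 1))) =
      (if j ∈ C then (if j ∈ B then p else 1 - p) else 1) *
        (if j ∈ R then (if j ∈ B' then q else 1 - q) else 1) * ∑ x ∈ t j, w j x := by
    intro B B' j
    by_cases hjC : j ∈ C
    · have hjR : j ∉ R := Finset.disjoint_left.1 hCR hjC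
      by_cases hjB : j ∈ B
      · simp only [hφ, hjC, hjR, hjB, if_true, if_false, mul_one, mul_ite, mul_zero]
        exact hC j hjC
      · simp only [hφ, hjC, hjR, hjB, if_true, if_false, mul_one, mul_ite, mul_zero]
        exact hsplit E j p (hC j hjC)
    · by_cases hjR : j ∈ R
      · by_cases hjB : j ∈ B'
        · simp only [hψ, hjC, hjR, hjB, if_true, if_false, one_mul, mul_one, mul_ite, mul_zero]
          exact hR j hjR
        · simp only [hψ, hjC, hjR, hjB, if_true, if_false, one_mul, mul_one, mul_ite, mul_zero]
          exact hsplit F j q (hR j hjR)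
      · simp [hjC, hjR]
  rw [Finset.sum_congr rfl fun G _ => h1 G, Finset.sum_comm]
  have h4 : ∀ B ∈ Finset.powersetCard b C,
      (∑ G ∈ Fintype.piFinset t, ∑ B' ∈ Finset.powersetCard a R,
        ∏ j, w j (G j) * ((if j ∈ C then φ B j (G j) else 1) *
          (if j ∈ R then ψ B' j (G j) else 1))) =
      (∏ j ∈ C, if j ∈ B then p else 1 - p) * (binomialProb R.card q a *
        ∏ j, ∑ x ∈ t j, w j x) := by
    intro B _
    rw [Finset.sum_comm, ← sum_powersetCard_prod_ite, Finset.sum_mul, Finset.mul_sum]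
    refine Finset.sum_congr rfl fun B' _ => ?_
    rw [← Finset.prod_univ_sum t fun j x => w j x * ((if j ∈ C then φ B j x else 1) *
          (if j ∈ R then ψ B' j x else 1)), Finset.prod_congr rfl fun j _ => h3 B B' j,
      Finset.prod_mul_distrib, Finset.prod_mul_distrib, Fintype.prod_ite_mem,
      Fintype.prod_ite_mem, mul_assoc]
  rw [Finset.sum_congr rfl h4, ← Finset.sum_mul, sum_powersetCard_prod_ite, mul_assoc]

/-! ### Probabilities of one random neighbour set -/

lemma nbrProb_eq {Ω : PMF ℕ} (hΩ : ∀ d, Ω d ≠ 0 → d ≤ k) (S : Finset (Fin k)) :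
    nbrProb k Ω S = wt Ω S.card / (k.choose S.card : ℝ) := by
  have hS : S.card ≤ k := by simpa using Finset.card_le_univ S
  have h : nbrLaw k Ω S = Ω S.card * ((k.choose S.card : ENNReal))⁻¹ := by
    rw [nbrLaw, PMF.bind_apply, tsum_eq_single S.card]
    · have hne : (Finset.powersetCard S.card (Finset.univ : Finset (Fin k))).Nonempty :=
        ⟨S, by simp [Finset.mem_powersetCard]⟩
      rw [dif_pos hne, PMF.uniformOfFinset_apply, if_pos (by simp [Finset.mem_powersetCard])]
      simp
    · intro d hd
      by_cases hΩd : Ω d = 0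
      · simp [hΩd]
      · have hne : (Finset.powersetCard d (Finset.univ : Finset (Fin k))).Nonempty := by
          rw [Finset.powersetCard_nonempty]; simpa using hΩ d hΩd
        rw [dif_pos hne, PMF.uniformOfFinset_apply,
          if_neg (by simpa [Finset.mem_powersetCard] using hd.symm), mul_zero]
  rw [nbrProb, h, ENNReal.toReal_mul, ENNReal.toReal_inv, ENNReal.toReal_natCast, wt,
    div_eq_mul_inv]

/-- Sum over a set by summing over its parts inside and outside `A`. -/
lemma sum_inter_sdiff (A : Finset (Fin k)) (F : Finset (Fin k) → Finset (Fin k) → ℝ) :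
    ∑ S, F (S ∩ A) (S \ A) = ∑ T ∈ A.powerset, ∑ U ∈ Aᶜ.powerset, F T U := by
  rw [← Finset.sum_product']
  refine Finset.sum_nbij' (fun S => (S ∩ A, S \ A)) (fun x => x.1 ∪ x.2) ?_ ?_ ?_ ?_ ?_
  · intro S _
    simp only [Finset.mem_product, Finset.mem_powerset]
    exact ⟨Finset.inter_subset_right, fun x hx => by
      rw [Finset.mem_compl]; exact (Finset.mem_sdiff.1 hx).2⟩
  · simp
  · intro S _
    ext x; simp only [Finset.mem_union, Finset.mem_inter, Finset.mem_sdiff]; tauto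
  · rintro ⟨T, U⟩ h
    simp only [Finset.mem_product, Finset.mem_powerset] at h
    have h1 : ∀ x ∈ T, x ∈ A := fun x hx => h.1 hx
    have h2 : ∀ x ∈ U, x ∉ A := fun x hx => Finset.mem_compl.1 (h.2 hx)
    refine Prod.ext ?_ ?_ <;> ext x <;>
      simp only [Finset.mem_union, Finset.mem_inter, Finset.mem_sdiff] <;>
      have := h1 x <;> have := h2 x <;> tauto
  · simp

/-- The probability that the trace of a neighbour set on `A` lies in a family of `i`-element
subsets of `A`. -/
lemma sum_nbrProb_inter_mem {dMax : ℕ} {Ω : PMF ℕ} (hdMax : dMax ≤ k)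
    (hΩ : ∀ d, Ω d ≠ 0 → 1 ≤ d ∧ d ≤ dMax) (A : Finset (Fin k)) {i : ℕ}
    (T : Finset (Finset (Fin k))) (hT : T ⊆ Finset.powersetCard i A) :
    (∑ S, if S ∩ A ∈ T then nbrProb k Ω S else 0) =
      T.card * ∑ d ∈ Finset.Icc i dMax,
        wt Ω d * (((k - A.card).choose (d - i) : ℝ) / (k.choose d : ℝ)) := by
  have hΩk : ∀ d, Ω d ≠ 0 → d ≤ k := fun d hd => (hΩ d hd).2.trans hdMax
  have hwt : ∀ d, dMax < d → wt Ω d = 0 := by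
    intro d hd
    have : Ω d = 0 := by
      by_contra h
      have := (hΩ d h).2
      omega
    simp [wt, this]
  set g : ℕ → ℝ := fun n => wt Ω n / (k.choose n : ℝ) with hg
  have h1 : ∀ S : Finset (Fin k), (if S ∩ A ∈ T then nbrProb k Ω S else 0) =
      if S ∩ A ∈ T then g ((S ∩ A).card + (S \ A).card) else 0 := by
    intro S
    rw [nbrProb_eq hΩk, ← Finset.card_inter_add_card_sdiff S A]
  rw [Finset.sum_congr rfl fun S _ => h1 S,
    sum_inter_sdiff A fun T' U => if T' ∈ T then g (T'.card + U.card) else 0]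
  have hcompl : (Aᶜ).card = k - A.card := by rw [Finset.card_compl, Fintype.card_fin]
  have h2 : ∀ T' ∈ A.powerset, (∑ U ∈ Aᶜ.powerset, if T' ∈ T then g (T'.card + U.card) else 0) =
      if T' ∈ T then ∑ n ∈ Finset.range (k - A.card + 1), ((k - A.card).choose n : ℝ) * g (i + n)
      else 0 := by
    intro T' _
    split_ifs with h
    · rw [(Finset.mem_powersetCard.1 (hT h)).2,
        Finset.sum_powerset_apply_card fun n => g (i + n), hcompl]
      simp
    · simp
  have h3 : ∑ n ∈ Finset.range (k - A.card + 1), ((k - A.card).choose n : ℝ) * g (i + n) =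
      ∑ d ∈ Finset.Icc i dMax,
        wt Ω d * (((k - A.card).choose (d - i) : ℝ) / (k.choose d : ℝ)) := by
    set N := k - A.card
    -- both index ranges are extended by terms that vanish: `choose` on one side, `Ω` on the other
    trans ∑ d ∈ Finset.Ico i (i + (N + dMax + 1)),
        wt Ω d * ((N.choose (d - i) : ℝ) / (k.choose d : ℝ))
    · rw [Finset.sum_Ico_eq_sum_range, Nat.add_sub_cancel_left]
      rw [Finset.sum_subset (Finset.range_subset_range.2 (show N + 1 ≤ N + dMax + 1 by omega))]
      · refine Finset.sum_congr rfl fun n _ => ?_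
        rw [Nat.add_sub_cancel_left, hg]
        ring
      · intro n _ hn
        rw [Finset.mem_range] at hn
        rw [Nat.choose_eq_zero_of_lt (by omega)]
        simp
    · symm
      refine Finset.sum_subset (fun d hd => ?_) fun d hd hd' => ?_
      · rw [Finset.mem_Icc] at hd
        rw [Finset.mem_Ico]
        omega
      · rw [Finset.mem_Ico] at hd
        rw [Finset.mem_Icc] at hd'
        rw [hwt d (by omega), zero_mul]
  rw [Finset.sum_congr rfl h2, h3, ← Finset.sum_filter, Finset.sum_const, nsmul_eq_mul]
  congr 3
  ext T'
  rw [Finset.mem_filter, and_iff_right_iff_imp, Finset.mem_powerset]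
  exact fun h => (Finset.mem_powersetCard.1 (hT h)).1

lemma sum_nbrProb_two_le {dMax : ℕ} {Ω : PMF ℕ} (hdMax : dMax ≤ k)
    (hΩ : ∀ d, Ω d ≠ 0 → 1 ≤ d ∧ d ≤ dMax) (A : Finset (Fin k)) :
    (∑ S, if 2 ≤ (S ∩ A).card then nbrProb k Ω S else 0) = cloudProb k dMax Ω A.card := by
  have h0 := sum_nbrProb_inter_mem hdMax hΩ A (i := 0) (Finset.powersetCard 0 A) subset_rfl
  have h1 := sum_nbrProb_inter_mem hdMax hΩ A (i := 1) (Finset.powersetCard 1 A) subset_rfl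
  have hwt : wt Ω 0 = 0 := by
    have : Ω 0 = 0 := by
      by_contra h
      have := (hΩ 0 h).1
      omega
    simp [wt, this]
  have hIcc : Finset.Icc 0 dMax = insert 0 (Finset.Icc 1 dMax) := by
    ext x; simp only [Finset.mem_Icc, Finset.mem_insert]; omega
  rw [hIcc, Finset.sum_insert (by simp), hwt] at h0
  simp only [Finset.card_powersetCard, Nat.choose_zero_right, Nat.choose_one_right, Nat.cast_one,
    zero_mul, zero_add, one_mul, Nat.sub_zero, Finset.mem_powersetCard, Finset.inter_subset_right,
    true_and] at h0 h1
  have hsum : (∑ S, if 2 ≤ (S ∩ A).card then nbrProb k Ω S else 0) +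
      (∑ S, if (S ∩ A).card = 1 then nbrProb k Ω S else 0) +
      (∑ S, if (S ∩ A).card = 0 then nbrProb k Ω S else 0) = 1 := by
    rw [← sum_nbrProb k Ω, ← Finset.sum_add_distrib, ← Finset.sum_add_distrib]
    refine Finset.sum_congr rfl fun S _ => ?_
    rcases lt_trichotomy (S ∩ A).card 1 with h | h | h
    · have : (S ∩ A).card = 0 := by omega
      simp [this]
    · simp [h]
    · have h2 : 2 ≤ (S ∩ A).card := h
      have h3 : (S ∩ A).card ≠ 1 := by omega
      have h4 : (S ∩ A).card ≠ 0 := by omega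
      rw [if_pos h2, if_neg h3, if_neg h4, add_zero, add_zero]
  rw [h0, h1] at hsum
  rw [cloudProb, eq_sub_iff_add_eq, ← hsum, add_assoc, Finset.mul_sum, ← Finset.sum_add_distrib]
  congr 1
  refine Finset.sum_congr rfl fun d _ => ?_
  ring

lemma sum_nbrProb_mem_card_eq_two {dMax : ℕ} {Ω : PMF ℕ} (hdMax : dMax ≤ k)
    (hΩ : ∀ d, Ω d ≠ 0 → 1 ≤ d ∧ d ≤ dMax) (A : Finset (Fin k)) {v : Fin k} (hv : v ∈ A) :
    (∑ S, if v ∈ S ∧ (S ∩ A).card = 2 then nbrProb k Ω S else 0) =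
      cloudToRippleProb k dMax Ω A.card := by
  set T := (Finset.powersetCard 1 (A.erase v)).image (insert v) with hT
  have hmem : ∀ S, S ∩ A ∈ T ↔ v ∈ S ∧ (S ∩ A).card = 2 := by
    intro S
    rw [hT, Finset.mem_image]
    constructor
    · rintro ⟨U, hU, hUS⟩
      obtain ⟨hU1, hU2⟩ := Finset.mem_powersetCard.1 hU
      have hvS : v ∈ S ∩ A := by rw [← hUS]; exact Finset.mem_insert_self _ _
      refine ⟨(Finset.mem_inter.1 hvS).1, ?_⟩
      rw [← hUS, Finset.card_insert_of_notMem fun h => by simpa using hU1 h, hU2]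
    · rintro ⟨hvS, h2⟩
      have hvSA : v ∈ S ∩ A := Finset.mem_inter.2 ⟨hvS, hv⟩
      refine ⟨(S ∩ A).erase v, ?_, Finset.insert_erase hvSA⟩
      rw [Finset.mem_powersetCard, Finset.card_erase_of_mem hvSA, h2]
      exact ⟨Finset.erase_subset_erase v Finset.inter_subset_right, rfl⟩
  have hTcard : (T.card : ℝ) = (A.card : ℝ) - 1 := by
    rw [hT, Finset.card_image_of_injOn, Finset.card_powersetCard, Nat.choose_one_right,
      Finset.card_erase_of_mem hv, Nat.cast_sub (Finset.card_pos.2 ⟨v, hv⟩), Nat.cast_one]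
    intro U hU U' hU' h
    have h1 : v ∉ U := fun h => by simpa using (Finset.mem_powersetCard.1 hU).1 h
    have h2 : v ∉ U' := fun h => by simpa using (Finset.mem_powersetCard.1 hU').1 h
    have h3 := congrArg (fun W => Finset.erase W v) h
    simpa [Finset.erase_insert h1, Finset.erase_insert h2] using h3
  have hT2 : T ⊆ Finset.powersetCard 2 A := by
    intro W hW
    obtain ⟨U, hU, rfl⟩ := Finset.mem_image.1 hW
    obtain ⟨hU1, hU2⟩ := Finset.mem_powersetCard.1 hU
    rw [Finset.mem_powersetCard, Finset.card_insert_of_notMem fun h => by simpa using hU1 h, hU2]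
    exact ⟨Finset.insert_subset hv (hU1.trans (Finset.erase_subset _ _)), rfl⟩
  have h := sum_nbrProb_inter_mem hdMax hΩ A T hT2
  simp only [hmem] at h
  rw [h, hTcard, cloudToRippleProb, Finset.mul_sum]
  refine Finset.sum_congr rfl fun d hd => ?_
  obtain ⟨hd2, hd⟩ := Finset.mem_Icc.1 hd
  obtain ⟨l, rfl⟩ : ∃ l, k = l + 2 := ⟨k - 2, by omega⟩
  obtain ⟨e, rfl⟩ : ∃ e, d = e + 2 := ⟨d - 2, by omega⟩
  have hc1 := Nat.add_one_mul_choose_eq (l + 1) (e + 1)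
  have hc2 := Nat.add_one_mul_choose_eq l e
  have hc : (((l + 2).choose (e + 2) : ℕ) : ℝ) * (e + 2) * (e + 1) =
      (l + 2) * (l + 1) * (l.choose e : ℕ) := by
    have hc1' : ((l : ℝ) + 1 + 1) * ((l + 1).choose (e + 1) : ℕ) =
      ((l + 2).choose (e + 2) : ℕ) * (e + 1 + 1) := by exact_mod_cast hc1
    have hc2' : ((l : ℝ) + 1) * (l.choose e : ℕ) = ((l + 1).choose (e + 1) : ℕ) * (e + 1) := by
      exact_mod_cast hc2
    linear_combination (-(e : ℝ) - 1) * hc1' - (l + 2) * hc2'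
  have h1 : (((l + 2).choose (e + 2) : ℕ) : ℝ) ≠ 0 := by
    exact_mod_cast (Nat.choose_pos (by omega)).ne'
  have h2 : ((l.choose e : ℕ) : ℝ) ≠ 0 := by
    exact_mod_cast (Nat.choose_pos (by omega)).ne'
  have h3 : ((l : ℝ) + 2 - 1) ≠ 0 := by
    have : (0 : ℝ) ≤ l := Nat.cast_nonneg l
    linarith
  simp only [Nat.add_sub_cancel]
  push_cast
  field_simp
  linear_combination (-wt Ω (e + 2) * ((A.card : ℝ) - 1) * ((l + 2 - A.card).choose e : ℝ)) * hc

/-! ### What the past reveals about the graph -/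

/-- What a run down to the active set `A` can reveal about a neighbour set `S`: nothing but
membership in the cloud if `S` still has at least two active elements, and otherwise the non-active
elements and the number of the active ones. -/
def profile (A S : Finset (Fin k)) : Option (Finset (Fin k) × ℕ) :=
  if 2 ≤ (S ∩ A).card then none else some (S \ A, (S ∩ A).card)

lemma profile_eq_iff {A S S' : Finset (Fin k)} :
    profile A S = profile A S' ↔ (2 ≤ (S ∩ A).card ∧ 2 ≤ (S' ∩ A).card) ∨
      (S \ A = S' \ A ∧ (S ∩ A).card = (S' ∩ A).card) := by
  unfold profile
  by_cases h : 2 ≤ (S ∩ A).card <;> by_cases h' : 2 ≤ (S' ∩ A).card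
  · simp [h, h']
  · simp only [h, h', if_true, if_false, reduceCtorEq, and_false, false_or, false_iff, not_and]
    intro _; omega
  · simp only [h, h', if_true, if_false, reduceCtorEq, false_and, false_or, false_iff, not_and]
    intro _; omega
  · simp [h, h']

lemma cloud_congr {G G' : Graph k m} {A : Finset (Fin k)}
    (h : ∀ j, profile A (G j) = profile A (G' j)) : cloud G A = cloud G' A := by
  ext j
  have := profile_eq_iff.1 (h j)
  rw [mem_cloud, mem_cloud]
  omega

lemma ripple_congr {G G' : Graph k m} {A : Finset (Fin k)}
    (h : ∀ j, profile A (G j) = profile A (G' j)) : ripple G A = ripple G' A := by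
  ext j
  have := profile_eq_iff.1 (h j)
  rw [mem_ripple, mem_ripple]
  omega

lemma sizes_congr {G G' : Graph k m} {A : Finset (Fin k)}
    (h : ∀ j, profile A (G j) = profile A (G' j)) : sizes G A = sizes G' A := by
  rw [sizes, sizes, cloud_congr h, ripple_congr h]

/-- Profiles become finer as the active set shrinks. -/
lemma profile_eq_of_erase {A S S' : Finset (Fin k)} {v : Fin k} (hv : v ∈ A)
    (h : profile (A.erase v) S = profile (A.erase v) S') : profile A S = profile A S' := by
  rw [profile_eq_iff] at h ⊢
  have h1 := card_inter_erase S A hv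
  have h2 := card_inter_erase S' A hv
  rcases h with h | ⟨h3, h4⟩
  · left; omega
  · right
    have h5 : v ∈ S ↔ v ∈ S' := by
      have := Finset.ext_iff.1 h3 v
      simpa using this
    refine ⟨?_, ?_⟩
    · ext x
      have := Finset.ext_iff.1 h3 x
      simp only [Finset.mem_sdiff, Finset.mem_erase] at this ⊢
      tauto
    · rw [h1, h2, h4]
      simp only [h5]

lemma pickProb_congr {G G' : Graph k m} {A : Finset (Fin k)} {v : Fin k}
    (h : ripple G A = ripple G' A) (hv : ∀ j ∈ ripple G A, (v ∈ G j ↔ v ∈ G' j)) :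
    pickProb G A v = pickProb G' A v := by
  unfold pickProb
  rw [← h, Finset.filter_congr hv]

lemma pickProb_congr_of_profile {G G' : Graph k m} {A : Finset (Fin k)} {v : Fin k} (hv : v ∈ A)
    (h : ∀ j, profile (A.erase v) (G j) = profile (A.erase v) (G' j)) :
    pickProb G A v = pickProb G' A v := by
  have hA := ripple_congr fun j => profile_eq_of_erase hv (h j)
  refine pickProb_congr hA fun j hj => ?_
  have h1 := mem_ripple.1 hj
  have h2 := mem_ripple.1 (hA ▸ hj)
  have h3 := card_inter_erase (G j) A hv
  rcases profile_eq_iff.1 (h j) with h4 | ⟨h4, -⟩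
  · omega
  · have := Finset.ext_iff.1 h4 v
    simpa using this

/-- Given the graph, the probability of reaching `A` with a prescribed past depends only on the
profiles at `A`: the past is conditionally independent of the rest of the graph. -/
lemma histWeight_congr (B : ℕ → Set (ℕ × ℕ)) {t : ℕ} (ht : t ≤ k) {G G' : Graph k m}
    {A : Finset (Fin k)} (h : ∀ j, profile A (G j) = profile A (G' j)) :
    histWeight G B t A = histWeight G' B t A := by
  classical
  induction t generalizing A with
  | zero =>
    have : ∀ G₁ : Graph k m, histWeight G₁ B 0 A =
        if sizes G₁ A ∈ B k ∧ Finset.univ = A then 1 else 0 := by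
      intro G₁
      unfold histWeight
      rw [trajectoryLaw, PMF.toOuterMeasure_pure_apply]
      have : (fun _ => ⟨Finset.univ, ∅⟩ : ℕ → DecoderState k) ∈
          {h : ℕ → DecoderState k | h ∈ sizeEvent G₁ B (k - 0) ∧ (h (k - 0)).active = A} ↔
          sizes G₁ A ∈ B k ∧ Finset.univ = A := by
        constructor
        · rintro ⟨h1, h2⟩
          dsimp only at h2
          subst h2
          exact ⟨h1 k (Nat.sub_le _ _) le_rfl, rfl⟩
        · rintro ⟨h1, rfl⟩
          refine ⟨fun w hw hw' => ?_, rfl⟩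
          obtain rfl : w = k := by omega
          exact h1
      simp only [this]
      split_ifs <;> rfl
    rw [this, this, sizes_congr h]
  | succ t ih =>
    rw [histWeight_succ G B ht, histWeight_succ G' B ht, sizes_congr h]
    congr 1
    refine Finset.sum_congr rfl fun A₁ _ => ?_
    rw [Finset.mul_sum, Finset.mul_sum]
    refine Finset.sum_congr rfl fun v hv => ?_
    split_ifs with h1
    · subst h1
      rw [pickProb_congr_of_profile hv h, ih (by omega) fun j => profile_eq_of_erase hv (h j)]
    · simp

/-! ### One step, given the past -/

/-- The neighbour sets with the same profile as `S`. -/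
def profileClass (A S : Finset (Fin k)) : Finset (Finset (Fin k)) :=
  Finset.univ.filter fun S' => profile A S' = profile A S

lemma mem_profileClass {A S S' : Finset (Fin k)} :
    S' ∈ profileClass A S ↔ profile A S' = profile A S := by
  simp [profileClass]

/-- A cloud symbol enters the ripple with conditional probability `p_u`, whichever symbol stops
being active. -/
lemma sum_profileClass_cloud {dMax : ℕ} {Ω : PMF ℕ} (hdMax : dMax ≤ k)
    (hΩ : ∀ d, Ω d ≠ 0 → 1 ≤ d ∧ d ≤ dMax) {A S : Finset (Fin k)} {v : Fin k} (hv : v ∈ A)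
    (hS : 2 ≤ (S ∩ A).card) :
    (∑ S' ∈ profileClass A S, if v ∈ S' ∧ (S' ∩ A).card = 2 then nbrProb k Ω S' else 0) =
      p k dMax Ω A.card * ∑ S' ∈ profileClass A S, nbrProb k Ω S' := by
  have h1 : profileClass A S = Finset.univ.filter fun S' => 2 ≤ (S' ∩ A).card := by
    ext S'
    rw [mem_profileClass, profile_eq_iff, Finset.mem_filter]
    simp only [Finset.mem_univ, true_and]
    omega
  have h2 := sum_nbrProb_two_le hdMax hΩ A
  have h3 := sum_nbrProb_mem_card_eq_two hdMax hΩ A hv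
  have h4 : (∑ S' ∈ profileClass A S, if v ∈ S' ∧ (S' ∩ A).card = 2 then nbrProb k Ω S' else 0) =
      cloudToRippleProb k dMax Ω A.card := by
    rw [← h3, h1, Finset.sum_filter]
    refine Finset.sum_congr rfl fun S' _ => ?_
    split_ifs with h5 h6 h6 <;> first | rfl | omega
  have h5 : ∑ S' ∈ profileClass A S, nbrProb k Ω S' = cloudProb k dMax Ω A.card := by
    rw [← h2, h1, Finset.sum_filter]
  -- needed when the cloud is almost surely empty: then `p` is the junk quotient `0 / 0 = 0`
  have h6 : cloudToRippleProb k dMax Ω A.card ≤ cloudProb k dMax Ω A.card := by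
    rw [← h4, ← h5]
    refine Finset.sum_le_sum fun S' _ => ?_
    split_ifs
    · exact le_rfl
    · exact nbrProb_nonneg _ _
  have h7 : 0 ≤ cloudToRippleProb k dMax Ω A.card := by
    rw [← h4]
    refine Finset.sum_nonneg fun S' _ => ?_
    split_ifs
    · exact nbrProb_nonneg _ _
    · exact le_rfl
  rw [h4, h5, p]
  by_cases h8 : cloudProb k dMax Ω A.card = 0
  · rw [h8, mul_zero]
    linarith
  · rw [div_mul_cancel₀ _ h8]

/-- The active neighbour of a ripple symbol is uniformly distributed. -/
lemma sum_profileClass_ripple {Ω : PMF ℕ} (hΩ : ∀ d, Ω d ≠ 0 → d ≤ k)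
    {A S : Finset (Fin k)} {v : Fin k} (hv : v ∈ A) (hS : (S ∩ A).card = 1) :
    (∑ S' ∈ profileClass A S, if v ∈ S' then nbrProb k Ω S' else 0) =
      1 / (A.card : ℝ) * ∑ S' ∈ profileClass A S, nbrProb k Ω S' := by
  have hmem : ∀ S', S' ∈ profileClass A S ↔ S' \ A = S \ A ∧ (S' ∩ A).card = 1 := by
    intro S'
    rw [mem_profileClass, profile_eq_iff, hS]
    constructor
    · rintro (h | h)
      · omega
      · exact h
    · exact Or.inr
  have hq : ∀ S' ∈ profileClass A S, nbrProb k Ω S' = nbrProb k Ω S := by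
    intro S' hS'
    obtain ⟨h1, h2⟩ := (hmem S').1 hS'
    rw [nbrProb_eq hΩ, nbrProb_eq hΩ, ← Finset.card_inter_add_card_sdiff S' A,
      ← Finset.card_inter_add_card_sdiff S A, h1, h2, hS]
  -- every active `x` belongs to exactly one member of the class
  have hone : ∀ x ∈ A, (∑ S' ∈ profileClass A S, if x ∈ S' then nbrProb k Ω S' else 0) =
      nbrProb k Ω S := by
    intro x hx
    have hins : insert x (S \ A) ∈ profileClass A S := by
      rw [hmem]
      refine ⟨?_, ?_⟩
      · ext y
        simp only [Finset.mem_sdiff, Finset.mem_insert]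
        refine ⟨?_, fun h => ⟨Or.inr h, h.2⟩⟩
        rintro ⟨rfl | h, h'⟩
        · exact absurd hx h'
        · exact h
      · rw [Finset.insert_inter_of_mem hx, Finset.sdiff_inter_self]
        simp
    rw [Finset.sum_eq_single (insert x (S \ A)), if_pos (Finset.mem_insert_self _ _), hq _ hins]
    · intro S' hS' hne
      rw [if_neg]
      intro hxS'
      refine hne ?_
      obtain ⟨h1, h2⟩ := (hmem S').1 hS'
      obtain ⟨y, hy⟩ := Finset.card_eq_one.1 h2
      have hxy : x ∈ S' ∩ A := Finset.mem_inter.2 ⟨hxS', hx⟩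
      rw [hy, Finset.mem_singleton] at hxy
      subst hxy
      rw [← h1, ← Finset.sdiff_union_inter S' A, hy]
      ext z
      have := Finset.ext_iff.1 hy z
      simp only [Finset.mem_inter, Finset.mem_singleton, Finset.mem_union, Finset.mem_sdiff,
        Finset.mem_insert] at this ⊢
      by_cases hz : z = x
      · subst hz; tauto
      · tauto
    · exact fun h => absurd hins h
  have htot : ∑ S' ∈ profileClass A S, nbrProb k Ω S' = A.card * nbrProb k Ω S := by
    have h1 : ∑ x ∈ A, (∑ S' ∈ profileClass A S, if x ∈ S' then nbrProb k Ω S' else 0) =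
        A.card * nbrProb k Ω S := by
      rw [Finset.sum_congr rfl hone, Finset.sum_const, nsmul_eq_mul]
    rw [← h1, Finset.sum_comm]
    refine Finset.sum_congr rfl fun S' hS' => ?_
    rw [← Finset.sum_filter, Finset.sum_const, Finset.filter_mem_eq_inter, Finset.inter_comm,
      ((hmem S').1 hS').2, one_smul]
  have hA : (A.card : ℝ) ≠ 0 := by exact_mod_cast (Finset.card_pos.2 ⟨v, hv⟩).ne'
  rw [hone v hv, htot]
  field_simp

lemma binomialProb_zero_left (q : ℝ) (a : ℕ) : binomialProb 0 q a = if a = 0 then 1 else 0 := by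
  rcases a with _ | a <;> simp [binomialProb]

open scoped Classical in
/-- Given the profiles, the numbers of moves and of departures in the next step are independent,
with the binomial and the shifted binomial law. The case of a nonempty ripple sums over the chosen
ripple symbol and its active neighbour `v`; the other ripple symbols leave the ripple if their
active neighbour is `v` too. -/
lemma sum_profileClass_step {dMax : ℕ} {Ω : PMF ℕ} (hdMax : dMax ≤ k)
    (hΩ : ∀ d, Ω d ≠ 0 → 1 ≤ d ∧ d ≤ dMax) (G₀ : Graph k m) {A : Finset (Fin k)}
    (hA : A.Nonempty) (b a : ℕ) :
    ∑ G ∈ Fintype.piFinset fun j => profileClass A (G₀ j), (∏ j, nbrProb k Ω (G j)) *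
        (∑ v ∈ A, if (cloud G A ∩ ripple G (A.erase v)).card = b ∧
          (ripple G A \ ripple G (A.erase v)).card = a then pickProb G A v else 0) =
      binomialProb (sizes G₀ A).1 (p k dMax Ω A.card) b *
        departureProb A.card (sizes G₀ A).2 a *
        ∑ G ∈ Fintype.piFinset fun j => profileClass A (G₀ j), ∏ j, nbrProb k Ω (G j) := by
  have hΩk : ∀ d, Ω d ≠ 0 → d ≤ k := fun d hd => (hΩ d hd).2.trans hdMax
  have hu : (A.card : ℝ) ≠ 0 := by exact_mod_cast hA.card_pos.ne'
  set C := cloud G₀ A with hC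
  set R := ripple G₀ A with hR
  have hsizes : sizes G₀ A = (C.card, R.card) := rfl
  have hCR : Disjoint C R := by
    rw [Finset.disjoint_left]
    intro j hj hj'
    rw [hC, mem_cloud] at hj
    rw [hR, mem_ripple] at hj'
    omega
  set t : Fin m → Finset (Finset (Fin k)) := fun j => profileClass A (G₀ j) with ht
  set E : Fin k → Finset (Fin k) → Prop := fun v S => v ∈ S ∧ (S ∩ A).card = 2 with hE
  rw [hsizes, ← Finset.prod_univ_sum t fun _ S => nbrProb k Ω S]
  have hcongr : ∀ G ∈ Fintype.piFinset t, ∀ v ∈ A,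
      (if (cloud G A ∩ ripple G (A.erase v)).card = b ∧
          (ripple G A \ ripple G (A.erase v)).card = a then pickProb G A v else 0) =
        (if (C.filter fun j => E v (G j)).card = b ∧ (R.filter fun j => v ∈ G j).card = a
          then 1 else 0) *
        (if R.Nonempty then ((R.filter fun j => v ∈ G j).card : ℝ) / R.card
          else 1 / (A.card : ℝ)) := by
    intro G hG v hv
    have h1 : ∀ j, profile A (G j) = profile A (G₀ j) := fun j =>
      mem_profileClass.1 (Fintype.mem_piFinset.1 hG j)
    rw [cloud_inter_ripple_erase G hv, ripple_sdiff_ripple_erase G hv, pickProb, cloud_congr h1,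
      ripple_congr h1, ite_mul, one_mul, zero_mul]
  have hsum : ∀ G ∈ Fintype.piFinset t, (∏ j, nbrProb k Ω (G j)) *
        (∑ v ∈ A, if (cloud G A ∩ ripple G (A.erase v)).card = b ∧
          (ripple G A \ ripple G (A.erase v)).card = a then pickProb G A v else 0) =
      ∑ v ∈ A, (∏ j, nbrProb k Ω (G j)) *
        ((if (C.filter fun j => E v (G j)).card = b ∧ (R.filter fun j => v ∈ G j).card = a
          then 1 else 0) *
        (if R.Nonempty then ((R.filter fun j => v ∈ G j).card : ℝ) / R.card
          else 1 / (A.card : ℝ))) := by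
    intro G hG
    rw [Finset.sum_congr rfl (hcongr G hG), Finset.mul_sum]
  rw [Finset.sum_congr rfl hsum, Finset.sum_comm]
  have hcloud : ∀ v ∈ A, ∀ j ∈ C, (∑ S ∈ t j, if E v S then nbrProb k Ω S else 0) =
      p k dMax Ω A.card * ∑ S ∈ t j, nbrProb k Ω S := by
    intro v hv j hj
    rw [← sum_profileClass_cloud hdMax hΩ hv (mem_cloud.1 hj)]
  have hripple : ∀ v ∈ A, ∀ j ∈ R, (∑ S ∈ t j, if v ∈ S then nbrProb k Ω S else 0) =
      1 / (A.card : ℝ) * ∑ S ∈ t j, nbrProb k Ω S := by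
    intro v hv j hj
    rw [← sum_profileClass_ripple hΩk hv (mem_ripple.1 hj)]
  by_cases hRne : R.Nonempty
  · have hr : (R.card : ℝ) ≠ 0 := by exact_mod_cast hRne.card_pos.ne'
    simp only [if_pos hRne]
    -- the weight of the event that ripple symbol `i` is chosen, with active neighbour `v`
    set w : Fin m → Fin k → Fin m → Finset (Fin k) → ℝ := fun i v j S =>
      (if j = i then (if v ∈ S then 1 else 0) else 1) * nbrProb k Ω S with hw
    have hwprod : ∀ i v (G : Graph k m), ∏ j, w i v j (G j) =
        (if v ∈ G i then 1 else 0) * ∏ j, nbrProb k Ω (G j) := by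
      intro i v G
      simp only [hw]
      rw [Finset.prod_mul_distrib, Finset.prod_ite_eq' Finset.univ i]
      simp
    have hwne : ∀ i v j, j ≠ i → w i v j = nbrProb k Ω := by
      intro i v j hj
      funext S
      simp only [hw, if_neg hj, one_mul]
    have hexp : ∀ v ∈ A, ∀ G ∈ Fintype.piFinset t, (∏ j, nbrProb k Ω (G j)) *
        ((if (C.filter fun j => E v (G j)).card = b ∧ (R.filter fun j => v ∈ G j).card = a
          then 1 else 0) * (((R.filter fun j => v ∈ G j).card : ℝ) / R.card)) =
        ∑ i ∈ R, 1 / (R.card : ℝ) * ((∏ j, w i v j (G j)) *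
          (if (C.filter fun j => E v (G j)).card = b ∧
            ((R.erase i).filter fun j => v ∈ G j).card + 1 = a then 1 else 0)) := by
      intro v _ G _
      have h1 : ((R.filter fun j => v ∈ G j).card : ℝ) = ∑ i ∈ R, if v ∈ G i then 1 else 0 := by
        rw [Finset.sum_boole]
      rw [h1, Finset.sum_div, Finset.mul_sum, Finset.mul_sum]
      refine Finset.sum_congr rfl fun i hi => ?_
      rw [hwprod]
      by_cases hvi : v ∈ G i
      · have h2 : ((R.erase i).filter fun j => v ∈ G j).card + 1 =
            (R.filter fun j => v ∈ G j).card := by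
          rw [Finset.filter_erase, Finset.card_erase_add_one (Finset.mem_filter.2 ⟨hi, hvi⟩)]
        rw [h2, if_pos hvi]
        ring
      · rw [if_neg hvi]
        ring
    have hterm : ∀ v ∈ A, ∀ i ∈ R, (∑ G ∈ Fintype.piFinset t, 1 / (R.card : ℝ) *
          ((∏ j, w i v j (G j)) * (if (C.filter fun j => E v (G j)).card = b ∧
            ((R.erase i).filter fun j => v ∈ G j).card + 1 = a then 1 else 0))) =
        1 / (R.card : ℝ) * (1 / (A.card : ℝ)) * (binomialProb C.card (p k dMax Ω A.card) b *
          departureProb A.card R.card a * ∏ j, ∑ S ∈ t j, nbrProb k Ω S) := by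
      intro v hv i hi
      rw [← Finset.mul_sum]
      rcases a with _ | a
      · simp [departureProb, hRne.ne_empty]
      · have hiC : ∀ j ∈ C, j ≠ i := by
          rintro j hj rfl
          exact Finset.disjoint_left.1 hCR hj hi
        have h1 := sum_piFinset_card_filter t (w i v) (E v) (fun S => v ∈ S) (C := C)
          (R := R.erase i) (hCR.mono_right (Finset.erase_subset _ _)) (p := p k dMax Ω A.card)
          (q := 1 / (A.card : ℝ))
          (fun j hj => by
            rw [hwne i v j (hiC j hj)]
            convert hcloud v hv j hj)
          (fun j hj => by
            rw [hwne i v j (Finset.ne_of_mem_erase hj)]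
            convert hripple v hv j (Finset.mem_of_mem_erase hj)) b a
        have h2 : ∀ j, ∑ S ∈ t j, w i v j S =
            (if j = i then 1 / (A.card : ℝ) else 1) * ∑ S ∈ t j, nbrProb k Ω S := by
          intro j
          split_ifs with hji
          · subst hji
            rw [← hripple v hv j hi]
            refine Finset.sum_congr rfl fun S _ => ?_
            simp [hw]
          · rw [hwne i v j hji, one_mul]
        rw [Finset.prod_congr rfl fun j _ => h2 j, Finset.prod_mul_distrib,
          Finset.prod_ite_eq' Finset.univ i, if_pos (Finset.mem_univ i),
          Finset.card_erase_of_mem hi] at h1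
        have h3 : departureProb A.card R.card (a + 1) =
            binomialProb (R.card - 1) (1 / (A.card : ℝ)) a := by
          simp [departureProb, hRne.ne_empty]
        rw [h3]
        simp only [Nat.add_right_cancel_iff]
        have h4 : ∀ x y : ℝ, x = y → 1 / (R.card : ℝ) * x = 1 / (R.card : ℝ) * y :=
          fun x y h => by rw [h]
        rw [mul_assoc (1 / (R.card : ℝ))]
        refine h4 _ _ (Eq.trans ?_ (h1.trans ?_))
        · congr!
        · ring
    have hv : ∀ v ∈ A, (∑ G ∈ Fintype.piFinset t, (∏ j, nbrProb k Ω (G j)) *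
        ((if (C.filter fun j => E v (G j)).card = b ∧ (R.filter fun j => v ∈ G j).card = a
          then 1 else 0) * (((R.filter fun j => v ∈ G j).card : ℝ) / R.card))) =
        1 / (A.card : ℝ) * (binomialProb C.card (p k dMax Ω A.card) b *
          departureProb A.card R.card a * ∏ j, ∑ S ∈ t j, nbrProb k Ω S) := by
      intro v hv
      rw [Finset.sum_congr rfl (hexp v hv), Finset.sum_comm, Finset.sum_congr rfl (hterm v hv),
        Finset.sum_const, nsmul_eq_mul]
      field_simp
    rw [Finset.sum_congr rfl hv, Finset.sum_const, nsmul_eq_mul]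
    field_simp
  · have hR0 : R = ∅ := Finset.not_nonempty_iff_eq_empty.1 hRne
    have hv : ∀ v ∈ A, (∑ G ∈ Fintype.piFinset t, (∏ j, nbrProb k Ω (G j)) *
        ((if (C.filter fun j => E v (G j)).card = b ∧ (R.filter fun j => v ∈ G j).card = a
          then 1 else 0) * (if R.Nonempty then ((R.filter fun j => v ∈ G j).card : ℝ) / R.card
          else 1 / (A.card : ℝ)))) =
        1 / (A.card : ℝ) * (binomialProb C.card (p k dMax Ω A.card) b *
          departureProb A.card R.card a * ∏ j, ∑ S ∈ t j, nbrProb k Ω S) := by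
      intro v hv
      have h1 := sum_piFinset_card_filter t (fun _ => nbrProb k Ω) (E v) (fun S => v ∈ S) hCR
        (fun j hj => by convert hcloud v hv j hj) (fun j hj => by convert hripple v hv j hj) b a
      have h2 : departureProb A.card R.card a = binomialProb R.card (1 / (A.card : ℝ)) a := by
        rw [hR0, Finset.card_empty, binomialProb_zero_left]
        simp [departureProb]
      rw [h2, ← h1, Finset.mul_sum]
      refine Finset.sum_congr rfl fun G _ => ?_
      rw [if_neg hRne, ← mul_assoc, mul_comm (1 / (A.card : ℝ))]
      congr!
    rw [Finset.sum_congr rfl hv, Finset.sum_const, nsmul_eq_mul]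
    field_simp

/-! ### The transition law -/

/-- The joint law of moves and departures in the step from `u`, on a past event that determines
the state at `u`. -/
lemma law_real_pastEvent_inter_moves_departures {dMax : ℕ} {Ω : PMF ℕ} (hdMax : dMax ≤ k)
    (hΩ : ∀ d, Ω d ≠ 0 → 1 ≤ d ∧ d ≤ dMax) {u : ℕ} (hu : 1 ≤ u) (huk : u ≤ k)
    (B : ℕ → Set (ℕ × ℕ)) {s : ℕ × ℕ} (hB : ∀ s' ∈ B u, s' = s) (b a : ℕ) :
    (law k m Ω).real (pastEvent k m u B ∩ {ω | ω.moves u = b ∧ ω.departures u = a}) =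
      binomialProb s.1 (p k dMax Ω u) b * departureProb u s.2 a *
        (law k m Ω).real (pastEvent k m u B) := by
  classical
  have h1 := law_real_pastEvent_inter (m := m) Ω hu huk B fun G A A' =>
    (cloud G A ∩ ripple G A').card = b ∧ (ripple G A \ ripple G A').card = a
  refine (Eq.trans ?_ h1).trans ?_
  · rfl
  rw [law_real_pastEvent Ω hu huk B]
  simp only [Finset.mul_sum (s := (Finset.univ : Finset (Finset (Fin k))))]
  rw [Finset.sum_comm, Finset.sum_comm (s := (Finset.univ : Finset (Graph k m))), Finset.mul_sum]
  refine Finset.sum_congr rfl fun A _ => ?_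
  by_cases hA : A.card = u
  swap
  · have h0 : ∀ G : Graph k m, histWeight G B (k - u) A = 0 := fun G =>
      histWeight_eq_zero_of_card_ne G B (by omega) (by omega)
    simp [h0]
  have hAne : A.Nonempty := Finset.card_pos.1 (by omega)
  -- sum over the classes of graphs with the same profiles, where `histWeight` is constant
  set prof : Graph k m → Fin m → Option (Finset (Fin k) × ℕ) := fun G j => profile A (G j)
    with hprof
  rw [← Finset.sum_fiberwise_of_maps_to (t := Finset.univ.image prof) (g := prof)
      fun G _ => Finset.mem_image_of_mem _ (Finset.mem_univ G),
    ← Finset.sum_fiberwise_of_maps_to (t := Finset.univ.image prof) (g := prof)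
      fun G _ => Finset.mem_image_of_mem _ (Finset.mem_univ G), Finset.mul_sum]
  refine Finset.sum_congr rfl fun y hy => ?_
  obtain ⟨G₀, -, rfl⟩ := Finset.mem_image.1 hy
  have hfib : Finset.univ.filter (fun G => prof G = prof G₀) =
      Fintype.piFinset fun j => profileClass A (G₀ j) := by
    ext G
    simp only [Finset.mem_filter, Finset.mem_univ, true_and, Fintype.mem_piFinset,
      mem_profileClass, hprof, funext_iff]
  rw [hfib]
  have hw : ∀ G ∈ Fintype.piFinset fun j => profileClass A (G₀ j),
      histWeight G B (k - u) A = histWeight G₀ B (k - u) A := fun G hG =>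
    histWeight_congr B (by omega) fun j => mem_profileClass.1 (Fintype.mem_piFinset.1 hG j)
  have hw1 : ∀ F : Graph k m → ℝ, ∑ G ∈ Fintype.piFinset fun j => profileClass A (G₀ j),
      (∏ j, nbrProb k Ω (G j)) * (histWeight G B (k - u) A * F G) =
      histWeight G₀ B (k - u) A * ∑ G ∈ Fintype.piFinset fun j => profileClass A (G₀ j),
        (∏ j, nbrProb k Ω (G j)) * F G := by
    intro F
    rw [Finset.mul_sum]
    exact Finset.sum_congr rfl fun G hG => by rw [hw G hG, mul_left_comm]
  have hw2 := hw1 fun _ => 1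
  simp only [mul_one] at hw2
  rw [hw1, hw2]
  by_cases hs : sizes G₀ A ∈ B u
  · have key := sum_profileClass_step hdMax hΩ G₀ hAne b a
    rw [hB _ hs, hA] at key
    rw [mul_left_comm, ← key]
    congr!
  · rw [histWeight_eq_zero_of_sizes_not_mem G₀ B _ (by rwa [show k - (k - u) = u by omega])]
    simp

lemma law_real_eq_sum_fiber (Ω : PMF ℕ) {ι : Type*} (f : Outcome k m → ι) (T : Finset ι)
    (F : Set (Outcome k m)) (hF : ∀ ω ∈ F, f ω ∈ T) :
    (law k m Ω).real F = ∑ i ∈ T, (law k m Ω).real (F ∩ {ω | f ω = i}) := by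
  classical
  rw [← MeasureTheory.measureReal_biUnion_finset]
  · congr 1
    ext ω
    simp only [Set.mem_iUnion, Set.mem_inter_iff, Set.mem_ofPred_eq, exists_prop]
    exact ⟨fun h => ⟨f ω, hF ω h, h, rfl⟩, fun ⟨_, _, h, _⟩ => h⟩
  · intro i _ i' _ hii'
    refine Set.disjoint_left.2 fun ω h h' => hii' ?_
    exact h.2.symm.trans h'.2
  · exact fun i _ => measurableSet_outcome _

lemma law_real_congr (Ω : PMF ℕ) {E F : Set (Outcome k m)}
    (h : ∀ ω, IsRun Ω ω → (ω ∈ E ↔ ω ∈ F)) : (law k m Ω).real E = (law k m Ω).real F := by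
  refine MeasureTheory.measureReal_congr ?_
  filter_upwards [ae_isRun Ω] with ω hω
  exact propext (h ω hω)

/-- The one-step transition law on a past event that determines the state at `u`. -/
lemma law_real_pastEvent_inter_S {dMax : ℕ} {Ω : PMF ℕ} (hdMax : dMax ≤ k)
    (hΩ : ∀ d, Ω d ≠ 0 → 1 ≤ d ∧ d ≤ dMax) {u : ℕ} (hu : 1 ≤ u) (huk : u ≤ k)
    (B : ℕ → Set (ℕ × ℕ)) {s : ℕ × ℕ} (hB : ∀ s' ∈ B u, s' = s) (s' : ℕ × ℕ) :
    (law k m Ω).real (pastEvent k m u B ∩ {ω | ω.S (u - 1) = s'}) =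
      transProb k dMax Ω u s s' * (law k m Ω).real (pastEvent k m u B) := by
  have hS : ∀ ω ∈ pastEvent k m u B, ω.S u = s := fun ω hω => hB _ (hω u le_rfl huk)
  rw [law_real_eq_sum_fiber Ω (fun ω => (ω.moves u, ω.departures u))
    (Finset.range (s.1 + 1) ×ˢ Finset.range (s.2 + 1)), Finset.sum_product, transProb,
    Finset.sum_mul]
  · refine Finset.sum_congr rfl fun b _ => ?_
    rw [Finset.sum_mul]
    refine Finset.sum_congr rfl fun a _ => ?_
    have hfib : ∀ ω, IsRun Ω ω → (ω ∈ pastEvent k m u B ∩ {ω | ω.S (u - 1) = s'} ∩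
        {ω | (ω.moves u, ω.departures u) = (b, a)} ↔
        (ω ∈ pastEvent k m u B ∩ {ω | ω.moves u = b ∧ ω.departures u = a}) ∧
          s' = (s.1 - b, s.2 - a + b)) := by
      intro ω hω
      simp only [Set.mem_inter_iff, Set.mem_ofPred_eq, Prod.mk.injEq]
      constructor
      · rintro ⟨⟨h1, h2⟩, h3, h4⟩
        refine ⟨⟨h1, h3, h4⟩, ?_⟩
        rw [← h2, hω.S_sub_one hu huk, hS ω h1, h3, h4]
      · rintro ⟨⟨h1, h3, h4⟩, h2⟩
        refine ⟨⟨h1, ?_⟩, h3, h4⟩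
        rw [h2, hω.S_sub_one hu huk, hS ω h1, h3, h4]
    split_ifs with h
    · rw [← law_real_pastEvent_inter_moves_departures hdMax hΩ hu huk B hB]
      exact law_real_congr Ω fun ω hω => (hfib ω hω).trans (and_iff_left h)
    · rw [zero_mul, ← MeasureTheory.measureReal_empty (μ := law k m Ω)]
      exact law_real_congr Ω fun ω hω => (hfib ω hω).trans
        ⟨fun h' => absurd h'.2 h, fun h' => absurd h' (Set.notMem_empty ω)⟩
  · rintro ω ⟨hω, -⟩
    have h := hS ω hω
    have h1 : ω.moves u ≤ (ω.S u).1 := Finset.card_le_card Finset.inter_subset_left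
    have h2 : ω.departures u ≤ (ω.S u).2 := Finset.card_le_card Finset.sdiff_subset
    rw [h] at h1 h2
    simp only [Finset.mem_product, Finset.mem_range]
    omega

lemma cond_law_real_apply (Ω : PMF ℕ) (H E : Set (Outcome k m)) :
    (ProbabilityTheory.cond (law k m Ω) H).real E =
      ((law k m Ω).real H)⁻¹ * (law k m Ω).real (H ∩ E) := by
  rw [MeasureTheory.measureReal_def, ProbabilityTheory.cond_apply (measurableSet_outcome H),
    ENNReal.toReal_mul, ENNReal.toReal_inv]
  rfl

lemma law_real_S_sub_one {dMax : ℕ} {Ω : PMF ℕ} (hdMax : dMax ≤ k)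
    (hΩ : ∀ d, Ω d ≠ 0 → 1 ≤ d ∧ d ≤ dMax) {u : ℕ} (hu : 1 ≤ u) (huk : u ≤ k) (s' : ℕ × ℕ) :
    (law k m Ω).real {ω | ω.S (u - 1) = s'} =
      ∑ s ∈ Finset.range (m + 1) ×ˢ Finset.range (m + 1),
        (law k m Ω).real {ω | ω.S u = s} * transProb k dMax Ω u s s' := by
  rw [law_real_eq_sum_fiber Ω (fun ω => ω.S u) _ _ fun ω _ => S_mem_range ω u]
  refine Finset.sum_congr rfl fun s _ => ?_
  -- only the state at `u` is prescribed
  have hpast : pastEvent k m u (fun w => {x | w = u → x = s}) = {ω | ω.S u = s} := by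
    ext ω
    constructor
    · exact fun h => h u le_rfl huk rfl
    · rintro h w - - rfl
      exact h
  rw [mul_comm, ← hpast, ← law_real_pastEvent_inter_S hdMax hΩ hu huk (fun w => {x | w = u → x = s})
    (fun x hx => hx rfl), Set.inter_comm]

/-! ### A single output symbol -/

/-- If `φ` depends on coordinate `j` only and `ψ` on the other coordinates only, they are
independent under the product law. The proof exchanges coordinate `j` with an independent copy. -/
lemma sum_prod_nbrProb_mul (Ω : PMF ℕ) (j : Fin m) (S₀ : Finset (Fin k))
    (φ : Finset (Fin k) → ℝ) (ψ : Graph k m → ℝ) :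
    ∑ G : Graph k m, (∏ i, nbrProb k Ω (G i)) * (φ (G j) * ψ (Function.update G j S₀)) =
      (∑ S, nbrProb k Ω S * φ S) *
        ∑ G : Graph k m, (∏ i, nbrProb k Ω (G i)) * ψ (Function.update G j S₀) := by
  have hprod : ∀ (G : Graph k m) S, nbrProb k Ω (G j) * ∏ i, nbrProb k Ω (Function.update G j S i) =
      nbrProb k Ω S * ∏ i, nbrProb k Ω (G i) := by
    intro G S
    rw [← Finset.mul_prod_erase Finset.univ (fun i => nbrProb k Ω (G i)) (Finset.mem_univ j),
      ← Finset.mul_prod_erase Finset.univ (fun i => nbrProb k Ω (Function.update G j S i))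
        (Finset.mem_univ j), Function.update_self]
    rw [Finset.prod_congr rfl fun i hi => by
      rw [Function.update_of_ne (Finset.ne_of_mem_erase hi)]]
    ring
  rw [Finset.sum_mul_sum, ← Finset.sum_product']
  trans ∑ x : Finset (Fin k) × Graph k m, nbrProb k Ω x.1 *
    ((∏ i, nbrProb k Ω (x.2 i)) * (φ (x.2 j) * ψ (Function.update x.2 j S₀)))
  · rw [Fintype.sum_prod_type]
    simp only
    rw [← Finset.sum_mul_sum, sum_nbrProb, one_mul]
  · -- the exchange of `G j` with the independent copy is an involution that keeps the weights
    refine Finset.sum_nbij' (fun x => (x.2 j, Function.update x.2 j x.1))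
      (fun x => (x.2 j, Function.update x.2 j x.1)) (by simp) (by simp) (by simp) (by simp) ?_
    rintro ⟨S, G⟩ -
    simp only [Function.update_idem]
    have := hprod G S
    linear_combination (-φ (G j) * ψ (Function.update G j S₀)) * this

open scoped Classical in
/-- As long as an output symbol `j` stays in the cloud it has no influence on the run: the run is
the same as if `j` were attached to all input symbols. So the neighbour set of `j` behaves as if it
were drawn independently of the active set. -/
lemma law_real_of_cloud (Ω : PMF ℕ) {u : ℕ} (hu : 1 ≤ u) (huk : u ≤ k) (j : Fin m)
    (Ψ : Graph k m → Finset (Fin k) → Finset (Fin k) → Prop)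
    (Θ : Finset (Fin k) → Fin k → Finset (Fin k) → Prop)
    (hΨ : ∀ G A, ∀ v ∈ A, Ψ G A (A.erase v) ↔ Θ A v (G j))
    (hΘ : ∀ A v S, Θ A v S → 2 ≤ (S ∩ A).card) (c : ℝ)
    (hc : ∀ A, A.card = u → ∀ v ∈ A, (∑ S, if Θ A v S then nbrProb k Ω S else 0) = c) :
    (law k m Ω).real {ω | Ψ ω.graph (ω.state u).active (ω.state (u - 1)).active} = c := by
  set B : ℕ → Set (ℕ × ℕ) := fun _ => Set.univ with hB
  set ψ : Finset (Fin k) → Fin k → Graph k m → ℝ := fun A v G =>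
    histWeight G B (k - u) A * pickProb G A v with hψ
  have hpast : pastEvent k m u B = Set.univ := Set.eq_univ_of_forall fun ω w _ _ => trivial
  have h1 := law_real_pastEvent_inter (m := m) Ω hu huk B Ψ
  rw [hpast, Set.univ_inter] at h1
  have hterm : ∀ G : Graph k m, ∀ A, ∀ v ∈ A,
      histWeight G B (k - u) A * (if Ψ G A (A.erase v) then pickProb G A v else 0) =
        (if Θ A v (G j) then 1 else 0) * ψ A v (Function.update G j Finset.univ) := by
    intro G A v hv
    simp only [hΨ G A v hv]
    split_ifs with h
    · have h2 := hΘ A v _ h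
      have h3 : 2 ≤ A.card := h2.trans (Finset.card_le_card Finset.inter_subset_right)
      have hprof : ∀ i, profile A (G i) =
          profile A ((Function.update G j Finset.univ : Graph k m) i) := by
        intro i
        by_cases hi : i = j
        · subst hi
          rw [Function.update_self, profile_eq_iff, Finset.univ_inter]
          exact Or.inl ⟨h2, h3⟩
        · rw [Function.update_of_ne hi]
      rw [one_mul, hψ]
      dsimp only
      rw [histWeight_congr B (by omega) hprof, pickProb_congr (ripple_congr hprof)]
      intro i hi
      have hij : i ≠ j := by
        rintro rfl
        rw [mem_ripple] at hi
        omega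
      rw [Function.update_of_ne hij]
    · simp
  have h2 : ∀ G : Graph k m, (∏ i, nbrProb k Ω (G i)) * ∑ A, histWeight G B (k - u) A *
        ∑ v ∈ A, (if Ψ G A (A.erase v) then pickProb G A v else 0) =
      ∑ A, ∑ v ∈ A, (∏ i, nbrProb k Ω (G i)) *
        ((if Θ A v (G j) then 1 else 0) * ψ A v (Function.update G j Finset.univ)) := by
    intro G
    rw [Finset.mul_sum]
    refine Finset.sum_congr rfl fun A _ => ?_
    rw [Finset.mul_sum, Finset.mul_sum]
    exact Finset.sum_congr rfl fun v hv => by rw [hterm G A v hv]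
  have hψ0 : ∀ A v G, A.card ≠ u → ψ A v G = 0 := by
    intro A v G hA
    rw [hψ]
    dsimp only
    rw [histWeight_eq_zero_of_card_ne G B (by omega) (by omega), zero_mul]
  have h3 : ∀ A, ∀ v ∈ A, ∑ G : Graph k m, (∏ i, nbrProb k Ω (G i)) *
        ((if Θ A v (G j) then 1 else 0) * ψ A v (Function.update G j Finset.univ)) =
      c * ∑ G : Graph k m, (∏ i, nbrProb k Ω (G i)) * ψ A v (Function.update G j Finset.univ) := by
    intro A v hv
    by_cases hA : A.card = u
    · rw [sum_prod_nbrProb_mul Ω j Finset.univ (fun S => if Θ A v S then 1 else 0) (ψ A v),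
        ← hc A hA v hv]
      simp only [mul_ite, mul_one, mul_zero]
    · simp [hψ0 A v _ hA]
  have hone : ∀ G : Graph k m, ∑ A, ∑ v ∈ A, ψ A v G = 1 := by
    intro G
    rw [← sum_histWeight_univ G (k - u)]
    refine Finset.sum_congr rfl fun A _ => ?_
    rw [hψ]
    dsimp only
    rw [← Finset.mul_sum]
    by_cases hA : A.card = u
    · rw [sum_pickProb G (Finset.card_pos.1 (by omega)), mul_one]
    · rw [histWeight_eq_zero_of_card_ne G B (by omega) (by omega), zero_mul]
  rw [h1, Finset.sum_congr rfl fun G _ => h2 G, Finset.sum_comm]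
  have h4 : ∀ A : Finset (Fin k), ∑ G : Graph k m, ∑ v ∈ A, (∏ i, nbrProb k Ω (G i)) *
        ((if Θ A v (G j) then 1 else 0) * ψ A v (Function.update G j Finset.univ)) =
      c * ∑ G : Graph k m, (∏ i, nbrProb k Ω (G i)) *
        ∑ v ∈ A, ψ A v (Function.update G j Finset.univ) := by
    intro A
    rw [Finset.sum_comm, Finset.sum_congr rfl (h3 A), ← Finset.mul_sum, Finset.sum_comm]
    simp only [Finset.mul_sum]
  rw [Finset.sum_congr rfl fun A _ => h4 A, ← Finset.mul_sum, Finset.sum_comm]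
  simp only [← Finset.mul_sum, hone, mul_one, sum_prod_nbrProb]

/-! ### The initial state -/

lemma law_real_graph (Ω : PMF ℕ) (Φ : Graph k m → Prop) [DecidablePred Φ] :
    (law k m Ω).real {ω | Φ ω.graph} =
      ∑ G : Graph k m, (∏ j, nbrProb k Ω (G j)) * if Φ G then 1 else 0 := by
  rw [law_real_apply]
  refine Finset.sum_congr rfl fun G _ => ?_
  congr 1
  split_ifs with h
  · have : {h' : ℕ → DecoderState k | (⟨G, h'⟩ : Outcome k m) ∈ {ω : Outcome k m | Φ ω.graph}} =
        Set.univ := Set.eq_univ_of_forall fun _ => h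
    rw [this, toOuterMeasure_univ]
    rfl
  · have : {h' : ℕ → DecoderState k | (⟨G, h'⟩ : Outcome k m) ∈ {ω : Outcome k m | Φ ω.graph}} =
        ∅ := Set.eq_empty_of_forall_notMem fun _ => h
    rw [this]
    simp

lemma sum_nbrProb_card_eq_one {dMax : ℕ} {Ω : PMF ℕ} (hdMax : dMax ≤ k)
    (hΩ : ∀ d, Ω d ≠ 0 → 1 ≤ d ∧ d ≤ dMax) :
    (∑ S : Finset (Fin k), if S.card = 1 then nbrProb k Ω S else 0) = wt Ω 1 := by
  -- the distribution has some mass, on a degree between `1` and `k`, so `k` is positive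
  obtain ⟨d, hd⟩ := Ω.support_nonempty
  have hd' := hΩ d hd
  have h := sum_nbrProb_inter_mem hdMax hΩ Finset.univ (i := 1)
    (Finset.powersetCard 1 Finset.univ) subset_rfl
  simp only [Finset.inter_univ, Finset.mem_powersetCard, Finset.subset_univ, true_and,
    Finset.card_powersetCard, Finset.card_univ, Fintype.card_fin, Nat.choose_one_right,
    Nat.sub_self] at h
  rw [h, Finset.sum_eq_single 1]
  · have hk : (k : ℝ) ≠ 0 := by
      have : k ≠ 0 := by omega
      exact_mod_cast this
    simp only [Nat.sub_self, Nat.choose_zero_right, Nat.choose_one_right, Nat.cast_one]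
    field_simp
  · intro e he he1
    rw [Finset.mem_Icc] at he
    rw [Nat.choose_eq_zero_of_lt (by omega)]
    simp
  · intro h1
    rw [Finset.mem_Icc] at h1
    omega

lemma law_real_S_init {dMax : ℕ} {Ω : PMF ℕ} (hdMax : dMax ≤ k)
    (hΩ : ∀ d, Ω d ≠ 0 → 1 ≤ d ∧ d ≤ dMax) (c r : ℕ) :
    (law k m Ω).real {ω | ω.S k = (c, r)} =
      if c + r = m then (m.choose r : ℝ) * wt Ω 1 ^ r * (1 - wt Ω 1) ^ c else 0 := by
  classical
  have hcard : ∀ ω : Outcome k m, IsRun Ω ω →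
      ω.S k = (m - (Finset.univ.filter fun j => (ω.graph j).card = 1).card,
        (Finset.univ.filter fun j => (ω.graph j).card = 1).card) := by
    intro ω hω
    have h1 : ω.S k = sizes ω.graph Finset.univ := by
      change sizes ω.graph (ω.state k).active = _
      rw [hω.init]
    have h2 : ripple ω.graph Finset.univ = Finset.univ.filter fun j => (ω.graph j).card = 1 := by
      ext j
      rw [mem_ripple, Finset.inter_univ]
      simp
    have h3 : cloud ω.graph Finset.univ =
        Finset.univ \ Finset.univ.filter fun j => (ω.graph j).card = 1 := by
      ext j
      have hpos : 1 ≤ (ω.graph j).card := by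
        refine (hΩ _ fun h0 => ?_).1
        have hz : nbrProb k Ω (ω.graph j) = 0 := by
          rw [nbrProb_eq fun d hd => (hΩ d hd).2.trans hdMax, wt, h0]
          simp
        rw [nbrProb, ENNReal.toReal_eq_zero_iff] at hz
        exact hz.elim (hω.graph j) (PMF.apply_ne_top _ _)
      simp only [mem_cloud, Finset.inter_univ, Finset.mem_sdiff, Finset.mem_univ, true_and,
        Finset.mem_filter]
      omega
    rw [h1, sizes, h2, h3, Finset.card_sdiff_of_subset (Finset.subset_univ _), Finset.card_univ,
      Fintype.card_fin]
  have hle : ∀ ω : Outcome k m, (Finset.univ.filter fun j => (ω.graph j).card = 1).card ≤ m := by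
    intro ω
    simpa using Finset.card_le_univ (Finset.univ.filter fun j => (ω.graph j).card = 1)
  split_ifs with h
  · rw [law_real_congr (F := {ω : Outcome k m |
      (Finset.univ.filter fun j => (ω.graph j).card = 1).card = r}) Ω fun ω hω => ?_]
    · rw [law_real_graph Ω fun G : Graph k m =>
        (Finset.univ.filter fun j => (G j).card = 1).card = r]
      have key := sum_piFinset_card_filter (ι := Fin m) (fun _ => Finset.univ)
        (fun _ => nbrProb k Ω) (fun S => S.card = 1) (fun _ => True) (C := Finset.univ) (R := ∅)
        (p := wt Ω 1) (q := 0) (by simp)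
        (fun j _ => by
          rw [sum_nbrProb, mul_one, ← sum_nbrProb_card_eq_one hdMax hΩ]
          congr!)
        (by simp) r 0
      rw [Fintype.piFinset_univ] at key
      simp only [Finset.filter_empty, Finset.card_empty, and_true, sum_nbrProb,
        Finset.prod_const_one, mul_one, binomialProb_zero_left, if_true, Finset.card_univ,
        Fintype.card_fin] at key
      rw [binomialProb, show m - r = c by omega] at key
      rw [← key]
      congr!
    · have := hle ω
      simp only [Set.mem_ofPred_eq, hcard ω hω, Prod.mk.injEq]
      omega
  · rw [← MeasureTheory.measureReal_empty (μ := law k m Ω)]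
    refine law_real_congr Ω fun ω hω => ?_
    have := hle ω
    simp only [Set.mem_ofPred_eq, hcard ω hω, Prod.mk.injEq, Set.mem_empty_iff_false, iff_false]
    omega

end LT

end

theorem mainTheorem3 (k m dMax : ℕ) (Ω : PMF ℕ) (hdMax : dMax ≤ k)
    (hΩ : ∀ d, Ω d ≠ 0 → 1 ≤ d ∧ d ≤ dMax) :
    -- `u` is the number of active input symbols
    (∀ᵐ ω ∂(LT.law k m Ω), ∀ u, u ≤ k → (ω.state u).active.card = u) ∧
    -- the law of one output symbol, which identifies `p_u` as a conditional probability
    (∀ u, 1 ≤ u → u ≤ k → ∀ j : Fin m,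
      (LT.law k m Ω).real {ω | j ∈ ω.cloudAt u} = LT.cloudProb k dMax Ω u ∧
      (LT.law k m Ω).real {ω | j ∈ ω.rippleAt (u - 1) ∧ j ∈ ω.cloudAt u} =
        LT.cloudToRippleProb k dMax Ω u ∧
      (ProbabilityTheory.cond (LT.law k m Ω) {ω | j ∈ ω.cloudAt u}).real
        {ω | j ∈ ω.rippleAt (u - 1)} = LT.p k dMax Ω u) ∧
    -- the initial distribution
    (∀ c r : ℕ, (LT.law k m Ω).real {ω | ω.S k = (c, r)} =
      if c + r = m then (m.choose r : ℝ) * LT.wt Ω 1 ^ r * (1 - LT.wt Ω 1) ^ c else 0) ∧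
    -- the bookkeeping of one step
    (∀ u, 1 ≤ u → u ≤ k → ∀ᵐ ω ∂(LT.law k m Ω),
      ω.S (u - 1) = ((ω.S u).1 - ω.moves u, (ω.S u).2 - ω.departures u + ω.moves u)) ∧
    -- given the past, moves and departures are independent, binomial and shifted binomial
    (∀ u, 1 ≤ u → u ≤ k → ∀ σ : ℕ → ℕ × ℕ, LT.law k m Ω (LT.history k m u σ) ≠ 0 → ∀ b a : ℕ,
      (ProbabilityTheory.cond (LT.law k m Ω) (LT.history k m u σ)).real
        {ω | ω.moves u = b ∧ ω.departures u = a} =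
      LT.binomialProb (σ u).1 (LT.p k dMax Ω u) b * LT.departureProb u (σ u).2 a) ∧
    -- the Markov property with its transition probabilities
    (∀ u, 1 ≤ u → u ≤ k → ∀ σ : ℕ → ℕ × ℕ, LT.law k m Ω (LT.history k m u σ) ≠ 0 →
      ∀ s' : ℕ × ℕ,
      (ProbabilityTheory.cond (LT.law k m Ω) (LT.history k m u σ)).real {ω | ω.S (u - 1) = s'} =
      LT.transProb k dMax Ω u (σ u) s') ∧
    -- the recursion for the state probabilities
    (∀ u, 1 ≤ u → u ≤ k → ∀ s' : ℕ × ℕ,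
      (LT.law k m Ω).real {ω | ω.S (u - 1) = s'} =
      ∑ s ∈ Finset.range (m + 1) ×ˢ Finset.range (m + 1),
        (LT.law k m Ω).real {ω | ω.S u = s} * LT.transProb k dMax Ω u s s') ∧
    -- the expected number of inactivations
    MeasureTheory.Integrable (fun ω => (ω.numInactivations : ℝ)) (LT.law k m Ω) ∧
    ∫ ω, (ω.numInactivations : ℝ) ∂(LT.law k m Ω) =
      ∑ u ∈ Finset.Icc 1 k, ∑ c ∈ Finset.range (m + 1),
        (LT.law k m Ω).real {ω | ω.S u = (c, 0)} := by
  have hhist : ∀ u σ, LT.history k m u σ = LT.pastEvent k m u fun w => {σ w} := fun _ _ => rfl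
  refine ⟨?_, fun u hu huk j => ?_, LT.law_real_S_init hdMax hΩ, fun u hu huk => ?_,
    fun u hu huk σ hσ b a => ?_, fun u hu huk σ hσ s' => ?_,
    fun u hu huk => LT.law_real_S_sub_one hdMax hΩ hu huk, LT.integrable_numInactivations Ω,
    LT.integral_numInactivations Ω⟩
  · filter_upwards [LT.ae_isRun Ω] with ω hω
    exact hω.active_card
  · have h1 : (LT.law k m Ω).real {ω | j ∈ ω.cloudAt u} = LT.cloudProb k dMax Ω u := by
      refine LT.law_real_of_cloud Ω hu huk j (fun G A _ => j ∈ LT.cloud G A)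
        (fun A _ S => 2 ≤ (S ∩ A).card) (fun G A v _ => LT.mem_cloud) (fun _ _ _ h => h) _ ?_
      intro A hA v _
      rw [← hA, ← LT.sum_nbrProb_two_le hdMax hΩ A]
      congr!
    have h2 : (LT.law k m Ω).real {ω | j ∈ ω.rippleAt (u - 1) ∧ j ∈ ω.cloudAt u} =
        LT.cloudToRippleProb k dMax Ω u := by
      refine LT.law_real_of_cloud Ω hu huk j (fun G A A' => j ∈ LT.ripple G A' ∧ j ∈ LT.cloud G A)
        (fun A v S => v ∈ S ∧ (S ∩ A).card = 2) (fun G A v hv => ?_) (fun _ _ _ h => h.2.ge) _ ?_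
      · have h := Finset.ext_iff.1 (LT.cloud_inter_ripple_erase G hv) j
        rw [Finset.mem_inter, Finset.mem_filter, LT.mem_cloud] at h
        rw [LT.mem_cloud, and_comm, h]
        exact ⟨fun h => h.2, fun h => ⟨h.2.ge, h⟩⟩
      · intro A hA v hv
        rw [← hA, ← LT.sum_nbrProb_mem_card_eq_two hdMax hΩ A hv]
        congr!
    refine ⟨h1, h2, ?_⟩
    have h3 : {ω : LT.Outcome k m | j ∈ ω.cloudAt u} ∩ {ω | j ∈ ω.rippleAt (u - 1)} =
        {ω | j ∈ ω.rippleAt (u - 1) ∧ j ∈ ω.cloudAt u} := Set.inter_comm _ _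
    rw [LT.cond_law_real_apply, h1, h3, h2, LT.p, div_eq_inv_mul]
  · filter_upwards [LT.ae_isRun Ω] with ω hω
    exact hω.S_sub_one hu huk
  · have hσ' : (LT.law k m Ω).real (LT.history k m u σ) ≠ 0 :=
      ENNReal.toReal_ne_zero.2 ⟨hσ, MeasureTheory.measure_ne_top _ _⟩
    rw [LT.cond_law_real_apply, hhist] at *
    rw [LT.law_real_pastEvent_inter_moves_departures hdMax hΩ hu huk _ (s := σ u) fun _ h => h]
    field_simp
  · have hσ' : (LT.law k m Ω).real (LT.history k m u σ) ≠ 0 :=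
      ENNReal.toReal_ne_zero.2 ⟨hσ, MeasureTheory.measure_ne_top _ _⟩
    rw [LT.cond_law_real_apply, hhist] at *
    rw [LT.law_real_pastEvent_inter_S hdMax hΩ hu huk _ (s := σ u) fun _ h => h]
    field_simp
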